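/- Let $n\ge 2$ be an integer. For a unit vector $\mathbf u\in\mathbb R^n$ (Euclidean norm $\|\cdot\|$) and $q\ge 0$, put $$\mathcal C_{\mathbf u}(e^q)=\{\mathbf x\in\mathbb R^n : \|\mathbf x\|\le 1,\ |\mathbf x\cdot\mathbf u|\le e^{-q}\},$$ and for $j=1,\dots,n$ let $L_{\mathbf u,j}(q)$ be the smallest real number $L\ge 0$ such that $e^L\mathcal C_{\mathbf u}(e^q)$ contains at least $j$ linearly independent points of $\mathbb Z^n$. Put $\mathbf L_{\mathbf u}(q)=(L_{\mathbf u,1}(q),\dots,L_{\mathbf u,n}(q))$. For $q_0\ge 0$, an $(n,0)$-system on $[q_0,\infty)$ is a function $\mathbf P=(P_1,\dots,P_n)\colon[q_0,\infty)\to\mathbb R^n$ such that: (S1) $0\le P_j(q)\le P_{j+1}(q)$ for $1\le j<n$ and $q\ge q_0$; (S2) $P_j(q_1)\le P_j(q_2)$ for $1\le j\le n$ and $q_0\le q_1\le q_2$; (S3) for $j=1,\dots,n$, the function $M_j=P_1+\cdots+P_j$ is continuous and piecewise linear with slopes $0$ and $1$ on $[q_0,\infty)$, which means that it is continuous, that it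 has a right derivative equal to $0$ or $1$ at each point $q\ge q_0$, and that it has a left derivative equal to $0$ or $1$ at each point $q>q_0$; (S4) $M_n(q)=q$ for $q\ge q_0$; (S5) if, for some $j\in\{1,\dots,n-1\}$, the function $M_j$ changes slope from $1$ to $0$ at a point $q>q_0$ (that is, its left derivative at $q$ is $1$ and its right derivative at $q$ is $0$), then $P_{j+1}(q)\le P_j(q)$. Theorem. Let $n\ge 2$, let $q_0\ge 0$ and let $\mathbf P\colon[q_0,\infty)\to\mathbb R^n$ be an $(n,0)$-system. Then there exists a unit vector $\mathbf u$ of $\mathbb R^n$ such that $$\|\mathbf P(q)-\mathbf L_{\mathbf u}(q)\|_\infty\le 3n^2(n+9)\qquad\text{for all } q\ge q_0,$$ where $\|\cdot\|_\infty$ is the maximum norm on $\mathbb R^n$. -/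

import Mathlib

open scoped Pointwise

noncomputable section

namespace ParamGeom

/-- The convex body `C_u(Q) = {x ∈ ℝⁿ ; ‖x‖ ≤ 1, |x · u| ≤ Q⁻¹}` (Euclidean norm). -/
def convexBody {n : ℕ} (u : EuclideanSpace ℝ (Fin n)) (Q : ℝ) :
    Set (EuclideanSpace ℝ (Fin n)) :=
  {x | ‖x‖ ≤ 1 ∧ |inner ℝ x u| ≤ Q⁻¹}

/-- The points of `ℝⁿ` with integer coordinates. -/
def integerPoints (n : ℕ) : Set (EuclideanSpace ℝ (Fin n)) :=
  {x | ∀ k, ∃ m : ℤ, x k = m}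

/-- The set `K` contains at least `j` linearly independent points of `ℤⁿ`. -/
def ContainsIndep {n : ℕ} (K : Set (EuclideanSpace ℝ (Fin n))) (j : ℕ) : Prop :=
  ∃ x : Fin j → EuclideanSpace ℝ (Fin n),
    LinearIndependent ℝ x ∧ ∀ i, x i ∈ integerPoints n ∧ x i ∈ K

/-- The real numbers `L ≥ 0` such that `e^L C_u(e^q)` contains at least `j` linearly
independent points of `ℤⁿ`. -/
def admissible {n : ℕ} (u : EuclideanSpace ℝ (Fin n)) (q : ℝ) (j : ℕ) : Set ℝ :=
  {L | 0 ≤ L ∧ ContainsIndep (Real.exp L • convexBody u (Real.exp q)) j}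

/-- The map `L_u = (L_{u,1}, …, L_{u,n})`: its component of (zero-based) index `j` is the smallest
real number `L ≥ 0` such that `e^L C_u(e^q)` contains at least `j + 1` linearly independent points
of `ℤⁿ`.  That the minimum is attained is `isLeast_succMin` below. -/
def succMin {n : ℕ} (u : EuclideanSpace ℝ (Fin n)) (q : ℝ) : Fin n → ℝ :=
  fun j => sInf (admissible u q (j + 1))

theorem mem_exp_smul_convexBody {n : ℕ} (u x : EuclideanSpace ℝ (Fin n)) (q L : ℝ) :
    x ∈ Real.exp L • convexBody u (Real.exp q) ↔
      ‖x‖ ≤ Real.exp L ∧ |inner ℝ x u| ≤ Real.exp (L - q) := by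
  have h0 : 0 < Real.exp L := Real.exp_pos L
  rw [Set.mem_smul_set_iff_inv_smul_mem₀ h0.ne']
  simp only [convexBody, Set.mem_ofPred_eq, norm_smul, inner_smul_left, abs_mul, norm_inv,
    Real.norm_eq_abs, abs_inv, conj_trivial, abs_of_pos h0, Real.exp_sub]
  rw [inv_mul_le_iff₀ h0, inv_mul_le_iff₀ h0, mul_one, div_eq_mul_inv]

theorem finite_integerPoints_inter_ball (n : ℕ) (R : ℝ) :
    {x : EuclideanSpace ℝ (Fin n) | x ∈ integerPoints n ∧ ‖x‖ ≤ R}.Finite := by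
  have hf : (Set.Icc (fun _ : Fin n => -⌈R⌉) (fun _ : Fin n => ⌈R⌉)).Finite := Set.finite_Icc _ _
  refine (hf.image fun m : Fin n → ℤ => WithLp.toLp 2 fun k => (m k : ℝ)).subset ?_
  rintro x ⟨hx, hR⟩
  choose m hm using hx
  refine ⟨m, ?_, ?_⟩
  · have h : ∀ k, |(m k : ℝ)| ≤ (⌈R⌉ : ℝ) := fun k => by
      rw [← hm k]
      exact ((PiLp.norm_apply_le x k).trans hR).trans (Int.le_ceil R)
    constructor <;> intro k
    · exact_mod_cast (abs_le.1 (h k)).1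
    · exact_mod_cast (abs_le.1 (h k)).2
  · ext k
    simp [hm k]

theorem mem_admissible {n : ℕ} (u : EuclideanSpace ℝ (Fin n)) (hu : ‖u‖ = 1) (q : ℝ)
    (hq : 0 ≤ q) (j : ℕ) (hj : j ≤ n) : q ∈ admissible u q j := by
  refine ⟨hq, fun i => EuclideanSpace.basisFun (Fin n) ℝ (Fin.castLE hj i), ?_, fun i => ⟨?_, ?_⟩⟩
  · exact (EuclideanSpace.basisFun (Fin n) ℝ).orthonormal.linearIndependent.comp _
      (Fin.castLE_injective hj)
  · intro k
    by_cases h : k = Fin.castLE hj i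
    · exact ⟨1, by simp [h]⟩
    · exact ⟨0, by simp [h]⟩
  · have h1 := (EuclideanSpace.basisFun (Fin n) ℝ).orthonormal.1 (Fin.castLE hj i)
    rw [mem_exp_smul_convexBody, sub_self, Real.exp_zero]
    refine ⟨h1.le.trans (Real.one_le_exp hq), (abs_real_inner_le_norm _ _).trans ?_⟩
    rw [h1, hu, one_mul]

/-- The minimum in the definition of `succMin` is attained. -/
theorem isLeast_succMin {n : ℕ} (u : EuclideanSpace ℝ (Fin n)) (hu : ‖u‖ = 1) (q : ℝ)
    (hq : 0 ≤ q) (j : Fin n) : IsLeast (admissible u q (j + 1)) (succMin u q j) := by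
  set S := admissible u q (j + 1) with hS
  have hqS : q ∈ S := mem_admissible u hu q hq _ j.2
  have hcl : IsClosed (S ∩ Set.Iic q) := by
    set F := {x : EuclideanSpace ℝ (Fin n) | x ∈ integerPoints n ∧ ‖x‖ ≤ Real.exp q}
    have hF : {x : Fin (j + 1) → EuclideanSpace ℝ (Fin n) |
        LinearIndependent ℝ x ∧ ∀ i, x i ∈ F}.Finite :=
      (Set.Finite.pi' fun _ => finite_integerPoints_inter_ball n (Real.exp q)).subset
        fun x hx => hx.2
    have heq : S ∩ Set.Iic q = ⋃ x ∈ {x : Fin (j + 1) → EuclideanSpace ℝ (Fin n) |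
        LinearIndependent ℝ x ∧ ∀ i, x i ∈ F}, {L | (0 ≤ L ∧ L ≤ q) ∧
          ∀ i, ‖x i‖ ≤ Real.exp L ∧ |inner ℝ (x i) u| ≤ Real.exp (L - q)} := by
      ext L
      simp only [hS, admissible, ContainsIndep, mem_exp_smul_convexBody, Set.mem_inter_iff,
        Set.mem_ofPred_eq, Set.mem_Iic, Set.mem_iUnion, exists_prop]
      constructor
      · rintro ⟨⟨h0, x, hx, h⟩, hL⟩
        exact ⟨x, ⟨hx, fun i => ⟨(h i).1, (h i).2.1.trans (Real.exp_le_exp.2 hL)⟩⟩, ⟨h0, hL⟩,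
          fun i => (h i).2⟩
      · rintro ⟨x, ⟨hx, hF⟩, ⟨h0, hL⟩, h⟩
        exact ⟨⟨h0, x, hx, fun i => ⟨(hF i).1, h i⟩⟩, hL⟩
    rw [heq]
    refine hF.isClosed_biUnion fun x _ => ?_
    simp only [Set.ofPred_and, Set.ofPred_forall]
    refine ((isClosed_le (by fun_prop) (by fun_prop)).inter
      (isClosed_le (by fun_prop) (by fun_prop))).inter (isClosed_iInter fun i =>
      (isClosed_le (by fun_prop) (by fun_prop)).inter (isClosed_le (by fun_prop) (by fun_prop)))
  have hb : BddBelow (S ∩ Set.Iic q) := ⟨0, fun L hL => hL.1.1⟩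
  have hm := hcl.csInf_mem ⟨q, hqS, le_refl q⟩ hb
  have hl : IsLeast S (sInf (S ∩ Set.Iic q)) := by
    refine ⟨hm.1, fun L hL => ?_⟩
    rcases le_total L q with h | h
    · exact csInf_le hb ⟨hL, h⟩
    · exact (Set.mem_Iic.1 hm.2).trans h
  have : succMin u q j = sInf (S ∩ Set.Iic q) := hl.csInf_eq
  rwa [this]

/-- `f` has right derivative `s` at `q`. -/
def HasRightSlope (f : ℝ → ℝ) (s q : ℝ) : Prop := HasDerivWithinAt f s (Set.Ici q) q

/-- `f` has left derivative `s` at `q`. -/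
def HasLeftSlope (f : ℝ → ℝ) (s q : ℝ) : Prop := HasDerivWithinAt f s (Set.Iic q) q

/-- `f` is continuous and piecewise linear with slopes `0` and `1` on `[q₀, ∞)`: it is continuous,
its right derivative is `0` or `1` at each point `q ≥ q₀`, and so is its left derivative at each
point `q > q₀`. -/
structure HasSlopesZeroOne (q₀ : ℝ) (f : ℝ → ℝ) : Prop where
  continuousOn : ContinuousOn f (Set.Ici q₀)
  right : ∀ q, q₀ ≤ q → HasRightSlope f 0 q ∨ HasRightSlope f 1 q
  left : ∀ q, q₀ < q → HasLeftSlope f 0 q ∨ HasLeftSlope f 1 q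

/-- The partial sum `P_1 + ⋯ + P_j`, with `j` the zero-based index of its last term. -/
def partialSum {n : ℕ} (P : ℝ → Fin n → ℝ) (j : Fin n) (q : ℝ) : ℝ :=
  ∑ i ∈ Finset.Iic j, P q i

/-- `P` restricts to an `(n, γ)`-system on `[q₀, ∞)`.  Only the values of `P` on `[q₀, ∞)` matter.
In `S1` and `S5`, `i` and `j` are consecutive indices. -/
structure IsSystem (n : ℕ) (γ q₀ : ℝ) (P : ℝ → Fin n → ℝ) : Prop where
  S1 : ∀ i j : Fin n, (i : ℕ) + 1 = j → ∀ q, q₀ ≤ q → -γ ≤ P q i ∧ P q i ≤ P q j + γ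
  S2 : ∀ j : Fin n, ∀ q₁ q₂, q₀ ≤ q₁ → q₁ ≤ q₂ → P q₁ j ≤ P q₂ j + γ
  S3 : ∀ j : Fin n, HasSlopesZeroOne q₀ (partialSum P j)
  S4 : ∀ q, q₀ ≤ q → ∑ i, P q i = q
  S5 : ∀ i j : Fin n, (i : ℕ) + 1 = j → ∀ q, q₀ < q →
    HasLeftSlope (partialSum P i) 1 q → HasRightSlope (partialSum P i) 0 q → P q j ≤ P q i + γ

end ParamGeom

end

/-!
The vector `u` is found as the limit of the normals of the hyperplanes spanned by `n - 1` members of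
bases of `ℤⁿ` whose logarithmic sizes follow the system `P`.

*Discretization of `P`.*  Fix `δ = 2 n + 10`, `Δ = n δ` and record only the integers `⌊P j / Δ⌋`.
Just before any time only one component of `P` varies (`IsSystem.exists_forall_ne_eq`), so these
levels go up one at a time.  As long as `P i < P (i + 1)` the partial sum `P 0 + ⋯ + P i` is convex
(`IsSystem.partialSum_le_chord`), so the level going up next is never above the one just reached
(`IsSystem.exists_levels_seq`).  Distributing the levels over `n` labels, one gets a history in
which a label, the mover, rises until another label, at a strictly lower level, takes over
(`exists_isLabelPath`).  The label `j` at level `r j` gets the size `a j = δ (n r j + j + 1)`; sizes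
of different labels then differ by at least `δ`, and `∑ a j` is close to the time.

*Bases.*  At each time there is a basis `x` of `ℤⁿ` with `‖x j‖ ≤ 2 e^{a j}` that is nearly
orthogonal once the mover `x k` is left out (`IsReduced`).  When `k'` takes over from `k`, the vector
`x k` is replaced by an integer vector congruent to it modulo the shorter vectors, and close to a
vector of the required norm orthogonal to all shorter vectors other than `x k'`
(`IsReduced.exists_step`).  Near orthogonality is witnessed by vectors `ν j`, orthogonal to the
vectors that are shorter than `x j`.  Only the `ν j` of vectors longer than the new one have to be
modified.  These modifications involve `ν j · x k`, which decreases geometrically as long as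
only shorter vectors are replaced and vanishes afterwards, so that the constants do not
deteriorate in the course of infinitely many steps.

*Conclusion.*  A vector orthogonal to the reduced family changes at each step by an amount
comparable to `e^{-∑ a j}`, hence converges, and its limit gives `u` with
`|x j · u| ≤ e^{a j + n + 2 - ∑ a j}` (`IsLabelPath.exists_unit`).  Thus the minima at `q = ∑ a j` are
at most the ordered `a j`, up to a constant.  A determinant of `n` independent integer points being
at least `1` in absolute value, they are not much smaller either
(`abs_succMin_sub_le_of_basis`).
-/

namespace ParamGeom

/-! ### Determinants of integer points -/

section

/-- The determinant of `n` vectors of `ℝⁿ` in the standard basis. -/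
noncomputable def coordDet {n : ℕ} (x : Fin n → EuclideanSpace ℝ (Fin n)) : ℝ :=
  (EuclideanSpace.basisFun (Fin n) ℝ).toBasis.det x

theorem coordDet_eq_det {n : ℕ} (x : Fin n → EuclideanSpace ℝ (Fin n)) :
    coordDet x = Matrix.det (Matrix.of fun i j => x j i) := by
  rw [coordDet, Module.Basis.det_apply]
  congr 1

/-- Hadamard's inequality. -/
theorem abs_coordDet_le_prod_norm {n : ℕ} (x : Fin n → EuclideanSpace ℝ (Fin n)) :
    |coordDet x| ≤ ∏ i, ‖x i‖ := by
  rcases n with _ | n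
  · simp [coordDet_eq_det]
  · have : Fact (Module.finrank ℝ (EuclideanSpace ℝ (Fin (n + 1))) = n + 1) := ⟨by simp⟩
    set b := EuclideanSpace.basisFun (Fin (n + 1)) ℝ
    have h := b.toBasis.orientation.abs_volumeForm_apply_le x
    rwa [Orientation.volumeForm_robust _ b rfl] at h

theorem coordDet_ne_zero_iff {n : ℕ} (x : Fin n → EuclideanSpace ℝ (Fin n)) :
    coordDet x ≠ 0 ↔ LinearIndependent ℝ x := by
  rw [← isUnit_iff_ne_zero, coordDet, ← Module.Basis.is_basis_iff_det]
  refine ⟨fun h => h.1, fun h => ⟨h, h.span_eq_top_of_card_eq_finrank' (by simp)⟩⟩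

theorem coordDet_update_add_sum {n : ℕ} (x : Fin n → EuclideanSpace ℝ (Fin n)) (k : Fin n)
    (S : Finset (Fin n)) (hk : k ∉ S) (c : Fin n → ℝ) :
    coordDet (Function.update x k (x k + ∑ j ∈ S, c j • x j)) = coordDet x := by
  rw [coordDet, AlternatingMap.map_update_add, Function.update_eq_self,
    AlternatingMap.map_update_sum]
  simp only [AlternatingMap.map_update_smul]
  rw [Finset.sum_eq_zero, add_zero]
  · rfl
  · intro j hj
    rw [AlternatingMap.map_update_self _ _ (fun h : k = j => hk (h ▸ hj)), smul_zero]

theorem one_le_abs_coordDet {n : ℕ} (x : Fin n → EuclideanSpace ℝ (Fin n))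
    (hx : ∀ i, x i ∈ integerPoints n) (hD : coordDet x ≠ 0) : 1 ≤ |coordDet x| := by
  choose m hm using hx
  have h : coordDet x = ((Matrix.of fun i j => m j i : Matrix (Fin n) (Fin n) ℤ).det : ℤ) := by
    rw [coordDet_eq_det, Int.cast_det]
    congr 1
    ext i j
    simp [hm]
  rw [h] at hD ⊢
  have h0 : (Matrix.of fun i j => m j i : Matrix (Fin n) (Fin n) ℤ).det ≠ 0 := by
    exact_mod_cast hD
  exact_mod_cast Int.one_le_abs h0

theorem det_inner_eq {n : ℕ} (v x : Fin n → EuclideanSpace ℝ (Fin n)) :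
    Matrix.det (Matrix.of fun i j => inner ℝ (v i) (x j)) = coordDet v * coordDet x := by
  rw [coordDet_eq_det, coordDet_eq_det, ← Matrix.det_transpose (Matrix.of fun i j => v j i),
    ← Matrix.det_mul]
  congr 1
  ext i j
  simp [Matrix.mul_apply, PiLp.inner_apply, mul_comm]

/-- If the matrix of inner products is triangular for the order given by `b`, its determinant is
the product of its diagonal. -/
theorem det_of_injective_triangular {n : ℕ} (M : Matrix (Fin n) (Fin n) ℝ) (b : Fin n → WithTop ℝ)
    (hb : Function.Injective b) (hM : ∀ i j, b j < b i → M i j = 0) : M.det = ∏ i, M i i := by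
  classical
  rw [Matrix.BlockTriangular.det (b := b) hM, Finset.prod_image (fun i _ j _ h => hb h)]
  refine Finset.prod_congr rfl fun i _ => ?_
  have : Unique {a // b a = b i} := ⟨⟨⟨i, rfl⟩⟩, fun a => Subtype.ext (hb a.2)⟩
  rw [Matrix.det_unique]
  have hd : (default : {a // b a = b i}) = ⟨i, rfl⟩ := Subsingleton.elim _ _
  rw [hd]
  rfl

/-- Multiplying the component along a unit vector `u` by `Q` multiplies determinants by `Q`. -/
theorem coordDet_stretch {n : ℕ} (u : EuclideanSpace ℝ (Fin n)) (hu : ‖u‖ = 1) (Q : ℝ)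
    (x : Fin n → EuclideanSpace ℝ (Fin n)) :
    coordDet (fun j => x j + ((Q - 1) * inner ℝ (x j) u) • u) = Q * coordDet x := by
  rw [coordDet_eq_det, coordDet_eq_det]
  have h1 : (Matrix.of fun i j => (x j + ((Q - 1) * inner ℝ (x j) u) • u) i) =
      (1 + Matrix.replicateCol Unit (fun i => (Q - 1) * u i) *
          Matrix.replicateRow Unit (fun i => u i)) *
        Matrix.of fun i j => x j i := by
    ext i j
    rw [add_mul, one_mul, Matrix.mul_assoc]
    simp [Matrix.mul_apply, PiLp.inner_apply]
    ring
  have h2 : (fun i => u i) ⬝ᵥ (fun i => (Q - 1) * u i) = Q - 1 := by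
    have : ∑ i, u i * u i = 1 := by
      have := real_inner_self_eq_norm_sq u
      rw [hu, PiLp.inner_apply] at this
      simpa [sq] using this
    simp only [dotProduct]
    calc ∑ i, u i * ((Q - 1) * u i) = (Q - 1) * ∑ i, u i * u i := by
          rw [Finset.mul_sum]; exact Finset.sum_congr rfl fun i _ => by ring
      _ = Q - 1 := by rw [this, mul_one]
  rw [h1, Matrix.det_mul, Matrix.det_one_add_replicateCol_mul_replicateRow, h2]
  ring

/-- Linearly independent integer points `y j` with `‖y j‖ ≤ e^{b j}` and
`|y j · u| ≤ e^{b j - q}` satisfy `q ≤ ∑ b j` up to a constant, since their determinant is a nonzero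
integer. -/
theorem le_sum_add_of_integerPoints {n : ℕ} (u : EuclideanSpace ℝ (Fin n)) (hu : ‖u‖ = 1)
    (q : ℝ) (hq : 0 ≤ q) (y : Fin n → EuclideanSpace ℝ (Fin n)) (b : Fin n → ℝ)
    (hy : ∀ i, y i ∈ integerPoints n) (hD : coordDet y ≠ 0)
    (h1 : ∀ i, ‖y i‖ ≤ Real.exp (b i)) (h2 : ∀ i, |inner ℝ (y i) u| ≤ Real.exp (b i - q)) :
    q ≤ ∑ i, b i + n := by
  have hQ : 1 ≤ Real.exp q := Real.one_le_exp hq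
  have hnorm : ∀ i, ‖y i + ((Real.exp q - 1) * inner ℝ (y i) u) • u‖ ≤ Real.exp (b i + 1) := by
    intro i
    have e1 : Real.exp q * Real.exp (b i - q) = Real.exp (b i) := by
      rw [← Real.exp_add]; ring_nf
    have e2 : (Real.exp q - 1) * |inner ℝ (y i) u| ≤ Real.exp (b i) := by
      rw [← e1]
      gcongr
      · linarith
      · exact h2 i
    calc _ ≤ ‖y i‖ + ‖((Real.exp q - 1) * inner ℝ (y i) u) • u‖ := norm_add_le _ _
      _ = ‖y i‖ + (Real.exp q - 1) * |inner ℝ (y i) u| := by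
        rw [norm_smul, hu, mul_one, Real.norm_eq_abs, abs_mul, abs_of_nonneg (by linarith)]
      _ ≤ Real.exp (b i) + Real.exp (b i) := add_le_add (h1 i) e2
      _ = Real.exp (b i) * 2 := by ring
      _ ≤ Real.exp (b i + 1) := by
        rw [Real.exp_add]
        gcongr
        linarith [Real.add_one_le_exp (1 : ℝ)]
  have h := abs_coordDet_le_prod_norm fun j => y j + ((Real.exp q - 1) * inner ℝ (y j) u) • u
  rw [coordDet_stretch u hu, abs_mul, abs_of_pos (Real.exp_pos q)] at h
  have h3 : Real.exp q ≤ Real.exp (∑ i, (b i + 1)) := by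
    calc Real.exp q ≤ Real.exp q * |coordDet y| :=
          le_mul_of_one_le_right (Real.exp_pos q).le (one_le_abs_coordDet y hy hD)
      _ ≤ _ := h
      _ ≤ ∏ i, Real.exp (b i + 1) :=
        Finset.prod_le_prod (fun i _ => norm_nonneg _) fun i _ => hnorm i
      _ = _ := (Real.exp_sum _ _).symm
  have h4 := Real.exp_le_exp.1 h3
  simpa [Finset.sum_add_distrib] using h4

end

/-! ### Reduced bases and their dual vectors -/

section

/-- The basis `x` of `ℤⁿ` has sizes at most `2 e^{a j}` and, the vector `x k` being left out, it is
nearly orthogonal: for `j ≠ k`, the vector `ν j` is orthogonal to all other `x m` with `m ≠ k` and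
`a m ≤ a j`, while its inner product with `x j` is, up to a factor `4`, as large as the norms allow.
The field `slack` leaves room for the modifications that `ν j` undergoes while vectors shorter than
`x j` are replaced. -/
structure IsReduced {n : ℕ} (a : Fin n → ℝ) (k : Fin n)
    (x ν : Fin n → EuclideanSpace ℝ (Fin n)) : Prop where
  mem_integerPoints : ∀ j, x j ∈ integerPoints n
  abs_det : |coordDet x| = 1
  norm_le : ∀ j, ‖x j‖ ≤ 2 * Real.exp (a j)
  norm_dual_le : ∀ j, j ≠ k → ‖ν j‖ ≤ 2
  inner_self : ∀ j, j ≠ k → inner ℝ (ν j) (x j) = Real.exp (a j)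
  inner_eq_zero : ∀ j, j ≠ k → ∀ m, m ≠ k → m ≠ j → a m ≤ a j → inner ℝ (ν j) (x m) = 0
  slack : ∀ j, j ≠ k → a k < a j →
    ‖ν j‖ + 1 / 4 * |inner ℝ (ν j) (x k)| * Real.exp (-a k) ≤ 2

variable {n : ℕ} {a : Fin n → ℝ} {k : Fin n} {x ν : Fin n → EuclideanSpace ℝ (Fin n)}

theorem IsReduced.linearIndependent (h : IsReduced a k x ν) : LinearIndependent ℝ x := by
  rw [← coordDet_ne_zero_iff]
  intro h0
  have := h.abs_det
  simp [h0] at this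

/-- The size of the omitted vector may be overestimated. -/
theorem IsReduced.mono (h : IsReduced a k x ν) {c : ℝ} (hc : a k ≤ c) :
    IsReduced (Function.update a k c) k x ν where
  mem_integerPoints := h.mem_integerPoints
  abs_det := h.abs_det
  norm_le j := by
    rcases eq_or_ne j k with rfl | hj
    · rw [Function.update_self]
      exact (h.norm_le j).trans (by gcongr)
    · rw [Function.update_of_ne hj]
      exact h.norm_le j
  norm_dual_le := h.norm_dual_le
  inner_self j hj := by
    rw [Function.update_of_ne hj]
    exact h.inner_self j hj
  inner_eq_zero j hj m hm hmj := by
    rw [Function.update_of_ne hj, Function.update_of_ne hm]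
    exact h.inner_eq_zero j hj m hm hmj
  slack j hj := by
    rw [Function.update_of_ne hj, Function.update_self]
    intro hcj
    refine le_trans ?_ (h.slack j hj (hc.trans_lt hcj))
    gcongr

/-- Dual vectors of a reduced family have norm comparable to the inverse of the sizes: starting
from `ν k'`, subtract multiples of the `ν m` for the longer `x m`, by increasing size. -/
theorem IsReduced.exists_dual (h : IsReduced a k x ν) {k' : Fin n} (hk' : k' ≠ k) :
    ∃ t : EuclideanSpace ℝ (Fin n), inner ℝ t (x k') = 1 ∧
      (∀ j, j ≠ k → j ≠ k' → inner ℝ t (x j) = 0) ∧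
      ‖t‖ ≤ 2 * 5 ^ n * Real.exp (-a k') := by
  classical
  have key : ∀ S : Finset (Fin n), (∀ j ∈ S, j ≠ k ∧ j ≠ k' ∧ a k' < a j) →
      ∃ t : EuclideanSpace ℝ (Fin n), inner ℝ t (x k') = 1 ∧
      (∀ j, j ≠ k → j ≠ k' → (a j ≤ a k' ∨ j ∈ S) → inner ℝ t (x j) = 0) ∧
      ‖t‖ ≤ 2 * 5 ^ S.card * Real.exp (-a k') := by
    intro S
    induction S using Finset.induction_on_max_value a with
    | empty =>
      intro _
      refine ⟨Real.exp (-a k') • ν k', ?_, ?_, ?_⟩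
      · rw [real_inner_smul_left, h.inner_self k' hk', ← Real.exp_add]
        simp
      · intro j hj hjk' hS
        rw [real_inner_smul_left, h.inner_eq_zero k' hk' j hj hjk' (by simpa using hS), mul_zero]
      · rw [norm_smul, Real.norm_eq_abs, abs_of_pos (Real.exp_pos _), Finset.card_empty, pow_zero,
          mul_one, mul_comm]
        gcongr
        exact h.norm_dual_le k' hk'
    | insert m S hmS hmax ih =>
      intro hS
      obtain ⟨t, ht1, ht0, htn⟩ := ih fun j hj => hS j (Finset.mem_insert_of_mem hj)
      obtain ⟨hmk, hmk', ham⟩ := hS m (Finset.mem_insert_self m S)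
      refine ⟨t - (inner ℝ t (x m) * Real.exp (-a m)) • ν m, ?_, ?_, ?_⟩
      · rw [inner_sub_left, real_inner_smul_left, h.inner_eq_zero m hmk k' hk' hmk'.symm ham.le,
          ht1]
        simp
      · intro j hj hjk' hjS
        rw [inner_sub_left, real_inner_smul_left]
        rcases eq_or_ne j m with rfl | hjm
        · rw [h.inner_self j hj, mul_assoc, ← Real.exp_add]
          simp
        · have hjS' : a j ≤ a k' ∨ j ∈ S := by
            rcases hjS with h1 | h1
            · exact Or.inl h1
            · exact Or.inr ((Finset.mem_insert.1 h1).resolve_left hjm)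
          have haj : a j ≤ a m := hjS'.elim (fun h1 => h1.trans ham.le) (hmax j)
          rw [ht0 j hj hjk' hjS', h.inner_eq_zero m hmk j hj hjm haj]
          simp
      · have e1 : ‖(inner ℝ t (x m) * Real.exp (-a m)) • ν m‖ ≤ 4 * ‖t‖ := by
          rw [norm_smul, norm_mul, Real.norm_eq_abs, Real.norm_eq_abs,
            abs_of_pos (Real.exp_pos _)]
          calc |inner ℝ t (x m)| * Real.exp (-a m) * ‖ν m‖
              ≤ (‖t‖ * (2 * Real.exp (a m))) * Real.exp (-a m) * 2 := by
                gcongr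
                · exact (abs_real_inner_le_norm _ _).trans (by gcongr; exact h.norm_le m)
                · exact h.norm_dual_le m hmk
            _ = 4 * ‖t‖ * (Real.exp (a m) * Real.exp (-a m)) := by ring
            _ = 4 * ‖t‖ := by rw [← Real.exp_add]; simp
        calc _ ≤ ‖t‖ + 4 * ‖t‖ := (norm_sub_le _ _).trans (by gcongr)
          _ = 5 * ‖t‖ := by ring
          _ ≤ 5 * (2 * 5 ^ S.card * Real.exp (-a k')) := by gcongr
          _ = _ := by rw [Finset.card_insert_of_notMem hmS]; ring
  obtain ⟨t, h1, h2, h3⟩ := key (Finset.univ.filter fun j => j ≠ k ∧ j ≠ k' ∧ a k' < a j)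
    fun j hj => (Finset.mem_filter.1 hj).2
  refine ⟨t, h1, fun j hj hj' => h2 j hj hj' ?_, h3.trans ?_⟩
  · rcases le_or_gt (a j) (a k') with h4 | h4
    · exact Or.inl h4
    · exact Or.inr (by simp [hj, hj', h4])
  · gcongr
    · norm_num
    · exact (Finset.card_le_univ _).trans (by simp)

/-- A combination `∑ j ∈ S, c j • x j` of given norm that is orthogonal to all `x j`, `j ∈ S`,
except `x k'`. -/
theorem exists_orthogonal_combination (hx : LinearIndependent ℝ x) (S : Finset (Fin n))
    {k' : Fin n} (hk' : k' ∈ S) {r : ℝ} (hr : 0 < r) :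
    ∃ c : Fin n → ℝ, ‖∑ j ∈ S, c j • x j‖ = r ∧
      (∀ j ∈ S, j ≠ k' → inner ℝ (∑ i ∈ S, c i • x i) (x j) = 0) ∧
      r ≤ |c k'| * ‖x k'‖ := by
  classical
  set U := Submodule.span ℝ (x '' (S.erase k' : Finset (Fin n)))
  obtain ⟨p, hp, v, hv, hpv⟩ := U.exists_add_mem_mem_orthogonal (x k')
  have hv0 : v ≠ 0 := by
    rintro rfl
    rw [add_zero] at hpv
    refine hx.notMem_span_image (s := (S.erase k' : Finset (Fin n))) (x := k') (by simp) ?_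
    rw [hpv]
    exact hp
  obtain ⟨d, hd⟩ : ∃ d : Fin n → ℝ, ∑ j ∈ S.erase k', d j • x j = p := by
    obtain ⟨d, hd⟩ := (Submodule.mem_span_image_finset_iff_exists_fun ℝ).1 hp
    refine ⟨fun j => if h : j ∈ S.erase k' then d ⟨j, h⟩ else 0, ?_⟩
    rw [← hd, ← Finset.sum_coe_sort]
    refine Finset.sum_congr rfl fun j _ => ?_
    simp only
    rw [dif_pos j.2]
  have hvn : 0 < ‖v‖ := norm_pos_iff.2 hv0
  set c : Fin n → ℝ := fun j => (r / ‖v‖) * (if j = k' then 1 else -d j)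
  have hT : ∑ j ∈ S, c j • x j = (r / ‖v‖) • v := by
    rw [← Finset.add_sum_erase S _ hk']
    have e1 : ∑ j ∈ S.erase k', c j • x j = -((r / ‖v‖) • p) := by
      rw [← hd, Finset.smul_sum, ← Finset.sum_neg_distrib]
      refine Finset.sum_congr rfl fun j hj => ?_
      simp only [c, if_neg (Finset.ne_of_mem_erase hj), mul_neg, neg_smul, mul_smul]
    rw [e1]
    simp only [c, if_true, mul_one]
    rw [hpv]
    module
  have hperp : ∀ j ∈ S, j ≠ k' → inner ℝ (∑ i ∈ S, c i • x i) (x j) = 0 := by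
    intro j hj hjk
    rw [hT, real_inner_smul_left, real_inner_comm,
      hv (x j) (Submodule.subset_span ⟨j, by simp [hj, hjk], rfl⟩), mul_zero]
  have hnorm : ‖∑ j ∈ S, c j • x j‖ = r := by
    rw [hT, norm_smul, norm_div, norm_norm, div_mul_cancel₀ _ hvn.ne', Real.norm_eq_abs,
      abs_of_pos hr]
  refine ⟨c, hnorm, hperp, ?_⟩
  set T := ∑ j ∈ S, c j • x j with hTdef
  have e2 : inner ℝ T T = c k' * inner ℝ T (x k') := by
    conv_lhs => rw [hTdef, inner_sum]
    rw [Finset.sum_eq_single_of_mem k' hk']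
    · rw [← hTdef, real_inner_smul_right]
    · intro j hj hjk
      rw [← hTdef, real_inner_smul_right, hperp j hj hjk, mul_zero]
  have e3 : r * r ≤ r * (|c k'| * ‖x k'‖) := by
    calc r * r = inner ℝ T T := by rw [real_inner_self_eq_norm_sq, hnorm, sq]
      _ ≤ |c k' * inner ℝ T (x k')| := by rw [e2]; exact le_abs_self _
      _ = |c k'| * |inner ℝ T (x k')| := abs_mul _ _
      _ ≤ |c k'| * (‖T‖ * ‖x k'‖) := by gcongr; exact abs_real_inner_le_norm _ _
      _ = _ := by rw [hnorm]; ring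
  exact le_of_mul_le_mul_left e3 hr

end

/-! ### Replacing one vector of a reduced basis -/

section

variable {n : ℕ} {a : Fin n → ℝ} {k : Fin n} {x ν : Fin n → EuclideanSpace ℝ (Fin n)}

theorem add_smul_mem_integerPoints {y z : EuclideanSpace ℝ (Fin n)} (hy : y ∈ integerPoints n)
    (hz : z ∈ integerPoints n) (m : ℤ) : y + (m : ℝ) • z ∈ integerPoints n := by
  intro i
  obtain ⟨p, hp⟩ := hy i
  obtain ⟨q, hq⟩ := hz i
  exact ⟨p + m * q, by simp [hp, hq]⟩

theorem add_sum_mem_integerPoints {y : EuclideanSpace ℝ (Fin n)} (hy : y ∈ integerPoints n)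
    (hx : ∀ j, x j ∈ integerPoints n) (S : Finset (Fin n)) (m : Fin n → ℤ) :
    y + ∑ j ∈ S, (m j : ℝ) • x j ∈ integerPoints n := by
  classical
  induction S using Finset.induction_on with
  | empty => simpa using hy
  | insert j S hj ih =>
    rw [Finset.sum_insert hj, add_comm ((m j : ℝ) • x j), ← add_assoc]
    exact add_smul_mem_integerPoints ih (hx j) (m j)

theorem natCast_add_two_le (n : ℕ) : (n : ℝ) + 2 ≤ 3 * 5 ^ n := by
  induction n with
  | zero => norm_num
  | succ n ih =>
    rw [pow_succ]
    push_cast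
    have : (1 : ℝ) ≤ 5 ^ n := one_le_pow₀ (by norm_num)
    linarith

/-- The replacement vector: an integer point `y`, congruent to `x k` modulo the shorter vectors,
that is close to a vector of norm `e^{a'}` orthogonal to the shorter vectors other than `x k'`. -/
theorem IsReduced.exists_replacement (h : IsReduced a k x ν) {δ a' : ℝ}
    (hδ : 1000 * 5 ^ n ≤ Real.exp δ) (ha' : a k + δ ≤ a')
    (hgap : ∀ j, j ≠ k → a j ≤ a' - δ ∨ a' < a j) {k' : Fin n} (hk' : k' ≠ k) (hak' : a k' ≤ a') :
    ∃ (m : Fin n → ℤ) (T : EuclideanSpace ℝ (Fin n)),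
      let S := Finset.univ.filter fun j => j ≠ k ∧ a j ≤ a'
      let y := x k + ∑ j ∈ S, (m j : ℝ) • x j
      (∀ j ∈ S, j ≠ k' → inner ℝ T (x j) = 0) ∧ ‖T‖ = Real.exp a' ∧
      ‖y - T‖ ≤ Real.exp a' / 100 ∧ Real.exp (a' - a k') / 2 - 1 / 2 ≤ |(m k' : ℝ)| := by
  set S := Finset.univ.filter fun j => j ≠ k ∧ a j ≤ a' with hS
  have hk'S : k' ∈ S := by simp [hS, hk', hak']
  obtain ⟨c, hcn, hcp, hck⟩ :=
    exists_orthogonal_combination h.linearIndependent S hk'S (Real.exp_pos a')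
  refine ⟨fun j => round (c j), ∑ j ∈ S, c j • x j, hcp, hcn, ?_, ?_⟩
  · have hsmall : ∀ b : ℝ, b ≤ a' - δ → Real.exp b ≤ Real.exp a' / (1000 * 5 ^ n) := by
      intro b hb
      rw [le_div_iff₀ (by positivity)]
      calc Real.exp b * (1000 * 5 ^ n) ≤ Real.exp (a' - δ) * Real.exp δ := by gcongr
        _ = Real.exp a' := by rw [← Real.exp_add]; ring_nf
    have e1 : x k + ∑ j ∈ S, ((round (c j) : ℤ) : ℝ) • x j - ∑ j ∈ S, c j • x j =
        x k + ∑ j ∈ S, ((round (c j) : ℝ) - c j) • x j := by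
      simp only [sub_smul, Finset.sum_sub_distrib]
      abel
    rw [e1]
    have e2 : ‖∑ j ∈ S, ((round (c j) : ℝ) - c j) • x j‖ ≤ n * (Real.exp a' / (1000 * 5 ^ n)) := by
      calc _ ≤ ∑ j ∈ S, ‖((round (c j) : ℝ) - c j) • x j‖ := norm_sum_le _ _
        _ ≤ ∑ j ∈ S, Real.exp a' / (1000 * 5 ^ n) := by
          refine Finset.sum_le_sum fun j hj => ?_
          obtain ⟨hjk, hja⟩ := (Finset.mem_filter.1 hj).2
          have e3 := hsmall (a j) ((hgap j hjk).resolve_right hja.not_gt)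
          rw [norm_smul, Real.norm_eq_abs, abs_sub_comm]
          calc |c j - round (c j)| * ‖x j‖ ≤ 1 / 2 * (2 * Real.exp (a j)) := by
                gcongr
                · exact abs_sub_round _
                · exact h.norm_le j
            _ = Real.exp (a j) := by ring
            _ ≤ _ := e3
        _ = S.card * (Real.exp a' / (1000 * 5 ^ n)) := by rw [Finset.sum_const, nsmul_eq_mul]
        _ ≤ _ := by
          gcongr
          exact (Finset.card_le_univ _).trans (by simp)
    calc _ ≤ ‖x k‖ + ‖∑ j ∈ S, ((round (c j) : ℝ) - c j) • x j‖ := norm_add_le _ _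
      _ ≤ 2 * (Real.exp a' / (1000 * 5 ^ n)) + n * (Real.exp a' / (1000 * 5 ^ n)) := by
        gcongr
        exact (h.norm_le k).trans (by gcongr; exact hsmall _ (by linarith))
      _ = (n + 2) * (Real.exp a' / (1000 * 5 ^ n)) := by ring
      _ ≤ (3 * 5 ^ n) * (Real.exp a' / (1000 * 5 ^ n)) := by
        gcongr
        exact natCast_add_two_le n
      _ = Real.exp a' * (3 / 1000) := by field_simp
      _ ≤ Real.exp a' / 100 := by linarith [Real.exp_pos a']
  · have e1 : Real.exp a' ≤ |c k'| * (2 * Real.exp (a k')) :=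
      hck.trans (by gcongr; exact h.norm_le k')
    have e2 : Real.exp (a' - a k') / 2 ≤ |c k'| := by
      rw [Real.exp_sub, div_div, div_le_iff₀ (by positivity)]
      linarith
    have e3 := abs_sub_round (c k')
    have e4 : |c k'| ≤ |c k' - round (c k')| + |(round (c k') : ℝ)| := by
      simpa using abs_add_le (c k' - round (c k')) (round (c k') : ℝ)
    linarith

/-- One step of the construction.  The vector `x k` is replaced by a vector of size `e^{a'}`, and
`x k'` becomes the omitted vector.  A vector orthogonal to the old reduced family has a
neighbour that is orthogonal to the new one. -/
theorem IsReduced.exists_step (h : IsReduced a k x ν) {δ a' : ℝ}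
    (hδ : 1000 * 5 ^ n ≤ Real.exp δ) (ha' : a k + δ ≤ a')
    (hgap : ∀ j, j ≠ k → a j ≤ a' - δ ∨ a' < a j) {k' : Fin n} (hk' : k' ≠ k) (hak' : a k' ≤ a') :
    ∃ x' ν' : Fin n → EuclideanSpace ℝ (Fin n),
      IsReduced (Function.update a k a') k' x' ν' ∧
      ∀ w : EuclideanSpace ℝ (Fin n), (∀ j, j ≠ k → inner ℝ w (x j) = 0) →
        ∃ w' : EuclideanSpace ℝ (Fin n), (∀ j, j ≠ k' → inner ℝ w' (x' j) = 0) ∧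
          ‖w' - w‖ ≤ 8 * 5 ^ n * |inner ℝ w (x k)| * Real.exp (-a') := by
  obtain ⟨m, T, hT0, hTn, hyT, hm⟩ := h.exists_replacement hδ ha' hgap hk' hak'
  obtain ⟨t, ht1, ht0, htn⟩ := h.exists_dual hk'
  set S := Finset.univ.filter fun j => j ≠ k ∧ a j ≤ a' with hS
  have hk'S : k' ∈ S := by simp [hS, hk', hak']
  have hkS : k ∉ S := by simp [hS]
  set y := x k + ∑ j ∈ S, (m j : ℝ) • x j with hy
  have h5 : (1 : ℝ) ≤ 5 ^ n := one_le_pow₀ (by norm_num)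
  have hexp : ∀ b : ℝ, b ≤ a' - δ → 1000 * 5 ^ n * Real.exp b ≤ Real.exp a' := by
    intro b hb
    calc 1000 * 5 ^ n * Real.exp b ≤ Real.exp δ * Real.exp (a' - δ) := by gcongr
      _ = Real.exp a' := by rw [← Real.exp_add]; ring_nf
  have hak'δ : a k' ≤ a' - δ := (hgap k' hk').resolve_right hak'.not_gt
  -- vectors orthogonal to the shorter vectors do not distinguish `y` from `x k`
  have hinner_y : ∀ w : EuclideanSpace ℝ (Fin n), (∀ j ∈ S, inner ℝ w (x j) = 0) →
      inner ℝ w y = inner ℝ w (x k) := by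
    intro w hw
    rw [hy, inner_add_right, inner_sum, Finset.sum_eq_zero, add_zero]
    intro j hj
    rw [real_inner_smul_right, hw j hj, mul_zero]
  have htk : |inner ℝ t (x k)| ≤ 4 / 1000 * Real.exp (a' - a k') := by
    calc |inner ℝ t (x k)| ≤ ‖t‖ * ‖x k‖ := abs_real_inner_le_norm _ _
      _ ≤ (2 * 5 ^ n * Real.exp (-a k')) * (2 * Real.exp (a k)) := by
        gcongr
        exact h.norm_le k
      _ = 4 / 1000 * (1000 * 5 ^ n * Real.exp (a k)) * Real.exp (-a k') := by ring
      _ ≤ 4 / 1000 * Real.exp a' * Real.exp (-a k') := by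
        gcongr
        exact hexp _ (by linarith)
      _ = _ := by rw [mul_assoc, ← Real.exp_add]; rfl
  set E := inner ℝ t y with hE
  have hEeq : E = inner ℝ t (x k) + m k' := by
    rw [hE, hy, inner_add_right, inner_sum, Finset.sum_eq_single_of_mem k' hk'S,
      real_inner_smul_right, ht1, mul_one]
    intro j hj hjk'
    rw [real_inner_smul_right, ht0 j (Finset.mem_filter.1 hj).2.1 hjk', mul_zero]
  have hEabs : Real.exp (a' - a k') / 4 ≤ |E| := by
    have e1 : 1000 ≤ Real.exp (a' - a k') := by
      calc (1000 : ℝ) ≤ 1000 * 5 ^ n := by linarith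
        _ ≤ Real.exp δ := hδ
        _ ≤ _ := Real.exp_le_exp.2 (by linarith)
    have e2 : |(m k' : ℝ)| ≤ |E| + |inner ℝ t (x k)| := by
      have := abs_sub E (inner ℝ t (x k))
      rw [hEeq, add_sub_cancel_left] at this
      rwa [hEeq]
    linarith
  have hEpos : 0 < |E| := lt_of_lt_of_le (by positivity) hEabs
  have hE0 : E ≠ 0 := abs_pos.1 hEpos
  -- subtracting a multiple of `τ` makes a vector orthogonal to `y`
  set τ := E⁻¹ • t with hτ
  have hτy : inner ℝ τ y = 1 := by
    rw [hτ, real_inner_smul_left, ← hE, inv_mul_cancel₀ hE0]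
  have hτ0 : ∀ j, j ≠ k → j ≠ k' → inner ℝ τ (x j) = 0 := by
    intro j hj hj'
    rw [hτ, real_inner_smul_left, ht0 j hj hj', mul_zero]
  have hinvE : |E|⁻¹ ≤ 4 * Real.exp (a k' - a') := by
    rw [inv_le_comm₀ hEpos (by positivity), mul_inv, ← Real.exp_neg, neg_sub]
    linarith
  have hτn : ‖τ‖ ≤ 8 * 5 ^ n * Real.exp (-a') := by
    rw [hτ, norm_smul, norm_inv, Real.norm_eq_abs]
    calc |E|⁻¹ * ‖t‖ ≤ 4 * Real.exp (a k' - a') * (2 * 5 ^ n * Real.exp (-a k')) := by gcongr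
      _ = 8 * 5 ^ n * (Real.exp (a k' - a') * Real.exp (-a k')) := by ring
      _ = _ := by rw [← Real.exp_add]; ring_nf
  have hτk' : |inner ℝ τ (x k')| ≤ 4 * Real.exp (a k' - a') := by
    rwa [hτ, real_inner_smul_left, ht1, mul_one, abs_inv]
  have hTy : 99 / 100 * (Real.exp a' * Real.exp a') ≤ inner ℝ T y := by
    have e1 : inner ℝ T y = inner ℝ T T + inner ℝ T (y - T) := by
      rw [← inner_add_right, add_sub_cancel]
    have e2 : |inner ℝ T (y - T)| ≤ Real.exp a' * (Real.exp a' / 100) :=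
      (abs_real_inner_le_norm _ _).trans (by rw [hTn]; gcongr)
    rw [e1, real_inner_self_eq_norm_sq, hTn]
    have := neg_abs_le (inner ℝ T (y - T))
    nlinarith
  have hTypos : 0 < inner ℝ T y := lt_of_lt_of_le (by positivity) hTy
  set η := (Real.exp a' / inner ℝ T y) • T with hη
  have hηy : inner ℝ η y = Real.exp a' := by
    rw [hη, real_inner_smul_left, div_mul_cancel₀ _ hTypos.ne']
  have hηn : ‖η‖ ≤ 100 / 99 := by
    rw [hη, norm_smul, hTn, Real.norm_eq_abs, abs_of_pos (by positivity), div_mul_eq_mul_div,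
      div_le_iff₀ hTypos]
    linarith
  set x' := Function.update x k y with hx'
  set ν' : Fin n → EuclideanSpace ℝ (Fin n) := fun j =>
    if j = k then η else if a' < a j then ν j - inner ℝ (ν j) (x k) • τ else ν j with hν'
  have hx'k : x' k = y := Function.update_self ..
  have hx'j : ∀ j, j ≠ k → x' j = x j := fun j hj => Function.update_of_ne hj ..
  have hν'k : ν' k = η := if_pos rfl
  have hν'gt : ∀ j, j ≠ k → a' < a j → ν' j = ν j - inner ℝ (ν j) (x k) • τ := by
    intro j hj haj
    simp only [hν', if_neg hj, if_pos haj]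
  have hν'le : ∀ j, j ≠ k → a j ≤ a' → ν' j = ν j := by
    intro j hj haj
    simp only [hν', if_neg hj, if_neg haj.not_gt]
  have hνy : ∀ j, j ≠ k → a' < a j → inner ℝ (ν j) y = inner ℝ (ν j) (x k) := by
    intro j hj haj
    refine hinner_y _ fun i hi => ?_
    obtain ⟨hik, hia⟩ := (Finset.mem_filter.1 hi).2
    exact h.inner_eq_zero j hj i hik (by rintro rfl; linarith) (hia.trans haj.le)
  -- the modification of `ν j` for the longer vectors is paid for by the field `slack`
  have hlong : ∀ j, j ≠ k → a' < a j →
      ‖ν' j‖ + 1 / 4 * |inner ℝ (ν' j) (x k')| * Real.exp (-a k') ≤ 2 := by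
    intro j hj haj
    have haδ : 0 ≤ δ := by
      by_contra hneg
      have := Real.exp_le_exp.2 (not_le.1 hneg).le
      rw [Real.exp_zero] at this
      linarith
    set ρ := |inner ℝ (ν j) (x k)| with hρ
    have e0 : inner ℝ (ν j) (x k') = 0 :=
      h.inner_eq_zero j hj k' hk' (by rintro rfl; linarith) (by linarith)
    have e1 : ‖ν' j‖ ≤ ‖ν j‖ + ρ * (8 * 5 ^ n * Real.exp (-a')) := by
      rw [hν'gt j hj haj]
      refine (norm_sub_le _ _).trans ?_
      rw [norm_smul, Real.norm_eq_abs]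
      gcongr
    have e2 : |inner ℝ (ν' j) (x k')| ≤ ρ * (4 * Real.exp (a k' - a')) := by
      rw [hν'gt j hj haj, inner_sub_left, e0, zero_sub, abs_neg, real_inner_smul_left, abs_mul]
      gcongr
    have e3 : 1 / 4 * |inner ℝ (ν' j) (x k')| * Real.exp (-a k') ≤ ρ * Real.exp (-a') := by
      calc _ ≤ 1 / 4 * (ρ * (4 * Real.exp (a k' - a'))) * Real.exp (-a k') := by gcongr
        _ = ρ * (Real.exp (a k' - a') * Real.exp (-a k')) := by ring
        _ = _ := by rw [← Real.exp_add]; ring_nf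
    have e4 : (8 * 5 ^ n + 1) * Real.exp (-a') ≤ 1 / 4 * Real.exp (-a k) := by
      have e5 := hexp (a k) (by linarith)
      rw [Real.exp_neg, Real.exp_neg, ← div_eq_mul_inv, ← div_eq_mul_inv,
        div_le_div_iff₀ (by positivity) (by positivity)]
      calc (8 * 5 ^ n + 1) * Real.exp (a k) ≤ 1 / 4 * (1000 * 5 ^ n) * Real.exp (a k) := by
            gcongr
            linarith
        _ ≤ _ := by linarith
    have e6 := h.slack j hj (by linarith)
    have e7 : ρ * ((8 * 5 ^ n + 1) * Real.exp (-a')) ≤ ρ * (1 / 4 * Real.exp (-a k)) := by gcongr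
    linarith
  refine ⟨x', ν', ?_, ?_⟩
  · constructor
    · intro j
      rcases eq_or_ne j k with rfl | hj
      · rw [hx'k]
        exact add_sum_mem_integerPoints (h.mem_integerPoints j) h.mem_integerPoints S m
      · rw [hx'j j hj]
        exact h.mem_integerPoints j
    · rw [hx', hy, coordDet_update_add_sum x k S hkS fun j => (m j : ℝ)]
      exact h.abs_det
    · intro j
      rcases eq_or_ne j k with rfl | hj
      · rw [hx'k, Function.update_self]
        have : ‖y‖ ≤ ‖T‖ + ‖y - T‖ := by
          simpa using norm_add_le T (y - T)
        rw [hTn] at this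
        linarith [Real.exp_pos a']
      · rw [hx'j j hj, Function.update_of_ne hj]
        exact h.norm_le j
    · intro j hj
      rcases eq_or_ne j k with rfl | hjk
      · rw [hν'k]
        linarith
      · rcases le_or_gt (a j) a' with haj | haj
        · rw [hν'le j hjk haj]
          exact h.norm_dual_le j hjk
        · have := hlong j hjk haj
          have : 0 ≤ 1 / 4 * |inner ℝ (ν' j) (x k')| * Real.exp (-a k') := by positivity
          linarith
    · intro j hj
      rcases eq_or_ne j k with rfl | hjk
      · rw [hν'k, hx'k, Function.update_self, hηy]
      · rw [hx'j j hjk, Function.update_of_ne hjk]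
        rcases le_or_gt (a j) a' with haj | haj
        · rw [hν'le j hjk haj]
          exact h.inner_self j hjk
        · rw [hν'gt j hjk haj, inner_sub_left, real_inner_smul_left, hτ0 j hjk hj, mul_zero,
            sub_zero]
          exact h.inner_self j hjk
    · intro j hj i hi hij hle
      rcases eq_or_ne j k with rfl | hjk
      · rw [Function.update_self, Function.update_of_ne hij] at hle
        rw [hν'k, hx'j i hij, hη, real_inner_smul_left, hT0 i (by simp [hS, hij, hle]) hi, mul_zero]
      · rw [Function.update_of_ne hjk] at hle
        rcases eq_or_ne i k with rfl | hik
        · rw [Function.update_self] at hle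
          have haj : a' < a j := by
            refine (hgap j hjk).resolve_left fun h1 => ?_
            have e1 : 1000 * 5 ^ n * Real.exp (a j) ≤ Real.exp a' := hexp _ h1
            have e2 : Real.exp a' ≤ Real.exp (a j) := Real.exp_le_exp.2 hle
            nlinarith [Real.exp_pos (a j)]
          rw [hx'k, hν'gt j hjk haj, inner_sub_left, real_inner_smul_left, hτy, hνy j hjk haj]
          ring
        · rw [Function.update_of_ne hik] at hle
          rw [hx'j i hik]
          have e1 := h.inner_eq_zero j hjk i hik hij hle
          rcases le_or_gt (a j) a' with haj | haj
          · rw [hν'le j hjk haj, e1]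
          · rw [hν'gt j hjk haj, inner_sub_left, real_inner_smul_left, hτ0 i hik hi, e1]
            ring
    · intro j hj hlt
      rw [Function.update_of_ne hk'] at hlt ⊢
      rw [hx'j k' hk']
      rcases eq_or_ne j k with rfl | hjk
      · rw [hν'k]
        have e1 : |inner ℝ η (x k')| ≤ 100 / 99 * (2 * Real.exp (a k')) :=
          (abs_real_inner_le_norm _ _).trans (by gcongr; exact h.norm_le k')
        have e2 : |inner ℝ η (x k')| * Real.exp (-a k') ≤ 200 / 99 := by
          calc _ ≤ 100 / 99 * (2 * Real.exp (a k')) * Real.exp (-a k') := by gcongr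
            _ = 200 / 99 * (Real.exp (a k') * Real.exp (-a k')) := by ring
            _ = _ := by rw [← Real.exp_add]; simp
        linarith
      · rw [Function.update_of_ne hjk] at hlt
        rcases le_or_gt (a j) a' with haj | haj
        · rw [hν'le j hjk haj, h.inner_eq_zero j hjk k' hk' hj.symm hlt.le]
          simpa using h.norm_dual_le j hjk
        · exact hlong j hjk haj
  · intro w hw
    have hwy : inner ℝ w y = inner ℝ w (x k) :=
      hinner_y w fun j hj => hw j (Finset.mem_filter.1 hj).2.1
    refine ⟨w - inner ℝ w (x k) • τ, ?_, ?_⟩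
    · intro j hj
      rcases eq_or_ne j k with rfl | hjk
      · rw [hx'k, inner_sub_left, real_inner_smul_left, hτy, hwy]
        ring
      · rw [hx'j j hjk, inner_sub_left, real_inner_smul_left, hτ0 j hjk hj, hw j hjk]
        ring
    · rw [sub_sub_cancel_left, norm_neg, norm_smul, Real.norm_eq_abs]
      calc |inner ℝ w (x k)| * ‖τ‖ ≤ |inner ℝ w (x k)| * (8 * 5 ^ n * Real.exp (-a')) := by gcongr
        _ = _ := by ring

end

/-! ### Volumes and existence of reduced bases -/

section

variable {n : ℕ} {a : Fin n → ℝ} {k : Fin n} {x ν : Fin n → EuclideanSpace ℝ (Fin n)}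

/-- The distance of the omitted vector to the hyperplane of the others is the inverse of the volume
of the latter; this is the triangular determinant of the inner products with `ν` and `w`. -/
theorem IsReduced.abs_inner_le (h : IsReduced a k x ν) (ha : Function.Injective a)
    (w : EuclideanSpace ℝ (Fin n)) (hw : ∀ j, j ≠ k → inner ℝ w (x j) = 0) :
    |inner ℝ w (x k)| ≤ ‖w‖ * 2 ^ n * Real.exp (a k - ∑ j, a j) := by
  classical
  set v := Function.update ν k w with hv
  have hvk : v k = w := Function.update_self ..
  have hvj : ∀ j, j ≠ k → v j = ν j := fun j hj => Function.update_of_ne hj ..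
  set b : Fin n → WithTop ℝ := fun j => if j = k then ⊤ else (a j : WithTop ℝ) with hb
  have hbinj : Function.Injective b := by
    intro i j hij
    simp only [hb] at hij
    split_ifs at hij with h1 h2 h2
    · rw [h1, h2]
    · exact absurd hij.symm (WithTop.coe_ne_top)
    · exact absurd hij (WithTop.coe_ne_top)
    · exact ha (WithTop.coe_injective hij)
  have hdet := det_inner_eq v x
  rw [det_of_injective_triangular _ b hbinj] at hdet
  · rw [← Finset.mul_prod_erase Finset.univ _ (Finset.mem_univ k)] at hdet
    simp only [Matrix.of_apply, hvk] at hdet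
    have e1 : ∏ j ∈ Finset.univ.erase k, inner ℝ (v j) (x j) =
        Real.exp (∑ j, a j - a k) := by
      rw [← Finset.sum_erase_eq_sub (Finset.mem_univ k), Real.exp_sum]
      refine Finset.prod_congr rfl fun j hj => ?_
      have hjk := Finset.ne_of_mem_erase hj
      rw [hvj j hjk, h.inner_self j hjk]
    have e2 : |coordDet v| ≤ ‖w‖ * 2 ^ n := by
      refine (abs_coordDet_le_prod_norm v).trans ?_
      rw [← Finset.mul_prod_erase Finset.univ _ (Finset.mem_univ k), hvk]
      gcongr
      calc ∏ j ∈ Finset.univ.erase k, ‖v j‖ ≤ ∏ j ∈ Finset.univ.erase k, (2 : ℝ) := by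
            refine Finset.prod_le_prod (fun j _ => norm_nonneg _) fun j hj => ?_
            have hjk := Finset.ne_of_mem_erase hj
            rw [hvj j hjk]
            exact h.norm_dual_le j hjk
        _ ≤ 2 ^ n := by
          rw [Finset.prod_const]
          exact pow_le_pow_right₀ (by norm_num) ((Finset.card_le_univ _).trans (by simp))
    have e3 : |inner ℝ w (x k)| * Real.exp (∑ j, a j - a k) = |coordDet v| := by
      rw [e1] at hdet
      rw [← mul_one |coordDet v|, ← h.abs_det, ← abs_mul, ← hdet, abs_mul,
        abs_of_pos (Real.exp_pos _)]
    calc |inner ℝ w (x k)| = |coordDet v| * Real.exp (a k - ∑ j, a j) := by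
          rw [← e3, mul_assoc, ← Real.exp_add]
          simp
      _ ≤ _ := by gcongr
  · intro i j hij
    simp only [hb] at hij
    simp only [Matrix.of_apply]
    split_ifs at hij with h1 h2 h2
    · exact absurd hij (lt_irrefl _)
    · exact absurd hij (not_top_lt)
    · rw [h2, hvk]
      exact hw j h1
    · have hij' : a j < a i := WithTop.coe_lt_coe.1 hij
      rw [hvj i h2]
      exact h.inner_eq_zero i h2 j h1 (by rintro rfl; exact lt_irrefl _ hij') hij'.le

theorem isReduced_basisFun (k : Fin n) :
    IsReduced (fun _ => 0) k (fun j => EuclideanSpace.basisFun (Fin n) ℝ j)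
      fun j => EuclideanSpace.basisFun (Fin n) ℝ j := by
  have hon := (EuclideanSpace.basisFun (Fin n) ℝ).orthonormal
  constructor
  · intro j i
    by_cases h : i = j
    · exact ⟨1, by simp [h]⟩
    · exact ⟨0, by simp [h]⟩
  · have : coordDet (fun j => EuclideanSpace.basisFun (Fin n) ℝ j) = 1 := by
      have := (EuclideanSpace.basisFun (Fin n) ℝ).toBasis.det_self
      rwa [OrthonormalBasis.coe_toBasis] at this
    rw [this, abs_one]
  · intro j
    rw [hon.1 j]
    simp
  · intro j _
    rw [hon.1 j]
    norm_num
  · intro j _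
    rw [real_inner_self_eq_norm_sq, hon.1 j]
    simp
  · intro j _ m _ hmj _
    exact hon.2 hmj.symm
  · intro j _ h
    exact absurd h (lt_irrefl _)

/-- Reduced bases exist for all well-spaced sizes: raise the vectors of the standard basis one by
one to their sizes. -/
theorem exists_isReduced {δ : ℝ} (hδ : 1000 * 5 ^ n ≤ Real.exp δ) (a : Fin n → ℝ)
    (hle : ∀ j, δ ≤ a j) (hgap : ∀ i j, i ≠ j → a i ≤ a j - δ ∨ a j < a i) (k : Fin n)
    (hk : 0 ≤ a k) :
    ∃ x ν, IsReduced a k x ν := by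
  classical
  have key : ∀ R : Finset (Fin n), ∀ k ∉ R,
      ∃ x ν, IsReduced (fun j => if j ∈ R then a j else 0) k x ν := by
    intro R
    induction R using Finset.induction_on with
    | empty => exact fun k _ => ⟨_, _, by simpa using isReduced_basisFun k⟩
    | insert p R hp ih =>
      intro k hk
      obtain ⟨x, ν, h⟩ := ih p hp
      rw [Finset.mem_insert, not_or] at hk
      have hδ0 : 0 ≤ δ := by
        by_contra hneg
        have e1 := Real.exp_le_exp.2 (not_le.1 hneg).le
        have e2 : (1 : ℝ) ≤ 5 ^ n := one_le_pow₀ (by norm_num)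
        rw [Real.exp_zero] at e1
        linarith
      obtain ⟨x', ν', h', -⟩ := h.exists_step (a' := a p) hδ (by simpa [hp] using hle p) (by
        intro j hj
        by_cases hjR : j ∈ R
        · simpa [hjR] using hgap j p hj
        · simpa [hjR] using Or.inl (hle p)) hk.1 (by
        simp only [hk.2, if_false]
        linarith [hle p])
      refine ⟨x', ν', ?_⟩
      convert h' using 1
      ext j
      rcases eq_or_ne j p with rfl | hj
      · simp
      · simp [hj]
  obtain ⟨x, ν, h⟩ := key (Finset.univ.erase k) k (by simp)
  refine ⟨x, ν, ?_⟩
  convert h.mono (c := a k) (by simpa using hk) using 1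
  ext j
  rcases eq_or_ne j k with rfl | hj
  · simp
  · simp [hj]

end

/-! ### Infinite sequences of reduced bases -/

section

variable {n : ℕ}

/-- The sizes attached to the labels `j` at levels `r j`.  The summand `j + 1` keeps the
sizes of labels at equal levels apart by at least `δ`. -/
def labelSize (δ : ℝ) (r : Fin n → ℕ) (j : Fin n) : ℝ := δ * ((n * r j + j + 1 : ℕ) : ℝ)

theorem labelSize_lt_iff {δ : ℝ} (hδ : 0 < δ) (r : Fin n → ℕ) (i j : Fin n) :
    labelSize δ r i < labelSize δ r j ↔ n * r i + i < n * r j + j := by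
  rw [labelSize, labelSize, mul_lt_mul_iff_right₀ hδ, Nat.cast_lt]
  omega

theorem labelSize_injective {δ : ℝ} (hδ : 0 < δ) (r : Fin n → ℕ) :
    Function.Injective (labelSize δ r) := by
  intro i j h
  have h1 := (labelSize_lt_iff hδ r i j).not.1 h.not_lt
  have h2 := (labelSize_lt_iff hδ r j i).not.1 h.not_gt
  have h3 : n * r i + i = n * r j + j := by omega
  have h4 := congrArg (· % n) h3
  simp only [Nat.mul_add_mod, Nat.mod_eq_of_lt i.2, Nat.mod_eq_of_lt j.2] at h4
  exact Fin.ext h4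

theorem labelSize_le_sub_or_lt {δ : ℝ} (hδ : 0 < δ) (r : Fin n → ℕ) {i j : Fin n} (hij : i ≠ j) :
    labelSize δ r i ≤ labelSize δ r j - δ ∨ labelSize δ r j < labelSize δ r i := by
  rcases lt_trichotomy (labelSize δ r i) (labelSize δ r j) with h | h | h
  · left
    rw [labelSize_lt_iff hδ] at h
    have h2 : ((n * r i + i + 1 : ℕ) : ℝ) + 1 ≤ ((n * r j + j + 1 : ℕ) : ℝ) := by
      exact_mod_cast (by omega)
    simp only [labelSize]
    nlinarith
  · exact absurd (labelSize_injective hδ r h) hij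
  · exact Or.inr h

theorem labelSize_lt_of_lt {δ : ℝ} (hδ : 0 < δ) (r : Fin n → ℕ) {i j : Fin n} (h : r i < r j) :
    labelSize δ r i < labelSize δ r j := by
  rw [labelSize_lt_iff hδ]
  have h1 := i.2
  have h2 : n * (r i + 1) ≤ n * r j := Nat.mul_le_mul_left n h
  rw [Nat.mul_succ] at h2
  omega

theorem le_labelSize {δ : ℝ} (hδ : 0 < δ) (r : Fin n → ℕ) (j : Fin n) : δ ≤ labelSize δ r j := by
  refine le_mul_of_one_le_right hδ.le ?_
  exact_mod_cast (by omega)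

theorem labelSize_update (δ : ℝ) (r : Fin n → ℕ) (k : Fin n) :
    labelSize δ (Function.update r k (r k + 1)) =
      Function.update (labelSize δ r) k (labelSize δ r k + n * δ) := by
  ext j
  rcases eq_or_ne j k with rfl | hj
  · simp only [labelSize, Function.update_self]
    push_cast
    ring
  · simp [labelSize, hj]

theorem sum_labelSize_update (δ : ℝ) (r : Fin n → ℕ) (k : Fin n) :
    ∑ j, labelSize δ (Function.update r k (r k + 1)) j = ∑ j, labelSize δ r j + n * δ := by
  rw [labelSize_update, Finset.sum_update_of_mem (Finset.mem_univ k),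
    ← Finset.add_sum_erase Finset.univ _ (Finset.mem_univ k), Finset.erase_eq]
  ring

/-- Admissible histories of levels: at each time the level of one label, the mover, goes up by one,
and a new mover starts from a strictly lower level than the one reached by the old mover. -/
structure IsLabelPath (r : ℕ → Fin n → ℕ) (k : ℕ → Fin n) : Prop where
  update : ∀ i, r (i + 1) = Function.update (r i) (k i) (r i (k i) + 1)
  mover : ∀ i, k (i + 1) = k i ∨ r (i + 1) (k (i + 1)) < r (i + 1) (k i)

theorem IsLabelPath.exists_step {r : ℕ → Fin n → ℕ} {k : ℕ → Fin n} (h : IsLabelPath r k) {δ : ℝ}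
    (hδ0 : 0 < δ) (hδ : 1000 * 5 ^ n ≤ Real.exp δ) (i : ℕ)
    {x ν : Fin n → EuclideanSpace ℝ (Fin n)} (hx : IsReduced (labelSize δ (r i)) (k i) x ν) :
    ∃ x' ν' : Fin n → EuclideanSpace ℝ (Fin n),
      IsReduced (labelSize δ (r (i + 1))) (k (i + 1)) x' ν' ∧
      ∀ w : EuclideanSpace ℝ (Fin n), (∀ j, j ≠ k i → inner ℝ w (x j) = 0) →
        ∃ w' : EuclideanSpace ℝ (Fin n), (∀ j, j ≠ k (i + 1) → inner ℝ w' (x' j) = 0) ∧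
          ‖w' - w‖ ≤ ‖w‖ * (8 * 10 ^ n * Real.exp (-∑ j, labelSize δ (r (i + 1)) j)) := by
  have hn : 1 ≤ n := (k i).pos
  have hupd := h.update i
  have hsize : labelSize δ (r (i + 1)) = Function.update (labelSize δ (r i)) (k i)
      (labelSize δ (r i) (k i) + n * δ) := by
    rw [hupd, labelSize_update]
  have hnδ : δ ≤ n * δ := le_mul_of_one_le_left hδ0.le (by exact_mod_cast hn)
  rcases eq_or_ne (k (i + 1)) (k i) with hk | hk
  · refine ⟨x, ν, ?_, fun w hw => ⟨w, by rwa [hk], ?_⟩⟩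
    · rw [hk, hsize]
      exact hx.mono (by linarith)
    · rw [sub_self, norm_zero]
      positivity
  · have hlt := labelSize_lt_of_lt hδ0 _ ((h.mover i).resolve_left hk)
    rw [hsize, Function.update_self, Function.update_of_ne hk] at hlt
    obtain ⟨x', ν', hx', hw'⟩ := hx.exists_step (a' := labelSize δ (r i) (k i) + n * δ) hδ
      (by linarith) (by
        intro j hj
        have := labelSize_le_sub_or_lt hδ0 (r (i + 1)) hj
        rwa [hsize, Function.update_self, Function.update_of_ne hj] at this) hk hlt.le
    refine ⟨x', ν', by rwa [hsize], fun w hw => ?_⟩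
    obtain ⟨w', hw0, hwn⟩ := hw' w hw
    refine ⟨w', hw0, hwn.trans ?_⟩
    have e1 := hx.abs_inner_le (labelSize_injective hδ0 _) w hw
    calc _ ≤ 8 * 5 ^ n * (‖w‖ * 2 ^ n *
          Real.exp (labelSize δ (r i) (k i) - ∑ j, labelSize δ (r i) j)) *
          Real.exp (-(labelSize δ (r i) (k i) + n * δ)) := by gcongr
      _ = ‖w‖ * (8 * (5 ^ n * 2 ^ n) *
          (Real.exp (labelSize δ (r i) (k i) - ∑ j, labelSize δ (r i) j) *
          Real.exp (-(labelSize δ (r i) (k i) + n * δ)))) := by ring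
      _ = _ := by
        rw [← mul_pow, ← Real.exp_add, hupd, sum_labelSize_update]
        norm_num
        left
        ring_nf

/-- Along every admissible history of levels, starting from reduced bases, some unit vector `u` is
almost orthogonal to the reduced bases at all times. -/
theorem IsLabelPath.exists_unit {r : ℕ → Fin n → ℕ} {k : ℕ → Fin n} (h : IsLabelPath r k) {δ : ℝ}
    (hδ0 : 0 < δ) (hδ : 1000 * 5 ^ n ≤ Real.exp δ) :
    ∃ u : EuclideanSpace ℝ (Fin n), ‖u‖ = 1 ∧ ∀ i, ∃ x : Fin n → EuclideanSpace ℝ (Fin n),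
      (∀ j, x j ∈ integerPoints n) ∧ LinearIndependent ℝ x ∧
      (∀ j, ‖x j‖ ≤ Real.exp (labelSize δ (r i) j + (n + 2))) ∧
      ∀ j, |inner ℝ (x j) u| ≤
        Real.exp (labelSize δ (r i) j + (n + 2) - ∑ m, labelSize δ (r i) m) := by
  have hn : 1 ≤ n := (k 0).pos
  -- the sequence of reduced bases, with vectors `w i` orthogonal to all but one of their members
  let St : ℕ → Type := fun i => {s : (Fin n → EuclideanSpace ℝ (Fin n)) ×
    (Fin n → EuclideanSpace ℝ (Fin n)) × EuclideanSpace ℝ (Fin n) //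
      IsReduced (labelSize δ (r i)) (k i) s.1 s.2.1 ∧ ∀ j, j ≠ k i → inner ℝ s.2.2 (s.1 j) = 0}
  have hstep : ∀ i (s : St i), ∃ s' : St (i + 1), ‖s'.1.2.2 - s.1.2.2‖ ≤
      ‖s.1.2.2‖ * (8 * 10 ^ n * Real.exp (-∑ j, labelSize δ (r (i + 1)) j)) := by
    rintro i ⟨⟨x, ν, w⟩, hx, hw⟩
    obtain ⟨x', ν', hx', hw'⟩ := h.exists_step hδ0 hδ i hx
    obtain ⟨w', hw0, hwn⟩ := hw' w hw
    exact ⟨⟨⟨x', ν', w'⟩, hx', hw0⟩, hwn⟩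
  obtain ⟨x₀, ν₀, hx₀⟩ := exists_isReduced hδ (labelSize δ (r 0)) (le_labelSize hδ0 _)
    (fun i j => labelSize_le_sub_or_lt hδ0 _) (k 0) (hδ0.le.trans (le_labelSize hδ0 _ _))
  obtain ⟨c, hcn, hcp, -⟩ := exists_orthogonal_combination hx₀.linearIndependent Finset.univ
    (Finset.mem_univ (k 0)) one_pos
  choose next hnext using hstep
  let s : ∀ i, St i := fun i => Nat.rec ⟨⟨x₀, ν₀, ∑ j, c j • x₀ j⟩, hx₀,
    fun j hj => hcp j (Finset.mem_univ j) hj⟩ next i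
  set w : ℕ → EuclideanSpace ℝ (Fin n) := fun i => (s i).1.2.2 with hwdef
  set q : ℕ → ℝ := fun i => ∑ j, labelSize δ (r i) j with hq
  -- the relative change of `w` at step `i` is at most `ε (i + 1)`, and `ε` decays geometrically
  set ε : ℕ → ℝ := fun i => 8 * 10 ^ n * Real.exp (-q i) with hε
  have hw0 : ‖w 0‖ = 1 := hcn
  have hws : ∀ i, ‖w (i + 1) - w i‖ ≤ ‖w i‖ * ε (i + 1) := fun i => hnext i (s i)
  have hεpos : ∀ i, 0 < ε i := fun i => by positivity
  have hbig : (1000 : ℝ) ^ n ≤ Real.exp (n * δ) := by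
    rw [Real.exp_nat_mul]
    refine pow_le_pow_left₀ (by norm_num) (le_trans ?_ hδ) n
    linarith [one_le_pow₀ (by norm_num : (1 : ℝ) ≤ 5) (n := n)]
  have h100 : (100 : ℝ) ≤ 100 ^ n := le_self_pow₀ (by norm_num) (by omega)
  have h10 : (1 : ℝ) ≤ 10 ^ n := one_le_pow₀ (by norm_num)
  have hqs : ∀ i, q (i + 1) = q i + n * δ := fun i => by
    simp only [hq, h.update, sum_labelSize_update]
  have hsmall : 10 ^ n * Real.exp (-(n * δ)) ≤ 1 / 100 := by
    rw [Real.exp_neg, ← div_eq_mul_inv, div_le_div_iff₀ (Real.exp_pos _) (by norm_num)]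
    calc (10 : ℝ) ^ n * 100 ≤ 10 ^ n * 100 ^ n := by gcongr
      _ = 1000 ^ n := by rw [← mul_pow]; norm_num
      _ ≤ 1 * Real.exp (n * δ) := by linarith
  have hεs : ∀ i, ε (i + 1) ≤ ε i / 2 := by
    intro i
    have e1 : ε (i + 1) = ε i * Real.exp (-(n * δ)) := by
      simp only [hε, hqs, neg_add, Real.exp_add]
      ring
    have e2 : Real.exp (-(n * δ)) ≤ 1 / 2 := by
      have := Real.exp_pos (-(n * δ))
      nlinarith
    rw [e1, div_eq_mul_one_div]
    exact mul_le_mul_of_nonneg_left e2 (hεpos i).le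
  have hε0 : ε 0 ≤ 8 / 100 := by
    have e1 : n * δ ≤ q 0 := by
      have := Finset.card_nsmul_le_sum Finset.univ (labelSize δ (r 0)) δ
        fun j _ => le_labelSize hδ0 _ j
      simpa using this
    calc ε 0 = 8 * (10 ^ n * Real.exp (-q 0)) := by simp only [hε]; ring
      _ ≤ 8 * (10 ^ n * Real.exp (-(n * δ))) := by gcongr
      _ ≤ _ := by linarith
  have hw2 : ∀ i, ‖w i‖ ≤ 2 - 4 * ε i := by
    intro i
    induction i with
    | zero => linarith
    | succ i ih =>
      have e1 : ‖w (i + 1)‖ ≤ ‖w i‖ + ‖w (i + 1) - w i‖ := by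
        simpa using norm_add_le (w i) (w (i + 1) - w i)
      have e2 : ‖w i‖ * ε (i + 1) ≤ 2 * ε (i + 1) := by
        refine mul_le_mul_of_nonneg_right ?_ (hεpos _).le
        linarith [hεpos i]
      linarith [hws i, hεs i, hεpos (i + 1)]
  have hε2 : ∀ i m, ε (i + m) ≤ ε i / 2 ^ m := by
    intro i m
    induction m with
    | zero => simp
    | succ m ih =>
      rw [pow_succ, ← div_div]
      exact (hεs (i + m)).trans (by gcongr)
  have hdist : ∀ i m, dist (w (i + m)) (w (i + (m + 1))) ≤ 4 * ε (i + 1) / 2 / 2 ^ m := by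
    intro i m
    rw [dist_comm, dist_eq_norm]
    have e1 : ‖w (i + m)‖ ≤ 2 := by linarith [hw2 (i + m), hεpos (i + m)]
    have e2 := hε2 (i + 1) m
    calc ‖w (i + m + 1) - w (i + m)‖ ≤ ‖w (i + m)‖ * ε (i + m + 1) := hws (i + m)
      _ ≤ 2 * ε (i + m + 1) := by gcongr
      _ = 2 * ε (i + 1 + m) := by ring_nf
      _ ≤ 2 * (ε (i + 1) / 2 ^ m) := by gcongr
      _ = _ := by ring
  obtain ⟨z, hz⟩ := cauchySeq_tendsto_of_complete
    (cauchySeq_of_le_geometric_two (f := fun m => w (0 + m)) (hdist 0))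
  have hz' : ∀ i, Filter.Tendsto (fun m => w (i + m)) Filter.atTop (nhds z) := by
    intro i
    simp only [zero_add] at hz
    refine (hz.comp (Filter.tendsto_add_atTop_nat i)).congr fun m => ?_
    simp only [Function.comp_apply, add_comm]
  have hwz : ∀ i, ‖w i - z‖ ≤ 4 * ε (i + 1) := by
    intro i
    have := dist_le_of_le_geometric_two_of_tendsto (hdist i) (hz' i) 0
    simpa [dist_eq_norm] using this
  have hznorm : 1 / 2 ≤ ‖z‖ := by
    have e1 := hwz 0
    have e2 : ‖w 0‖ ≤ ‖w 0 - z‖ + ‖z‖ := by simpa using norm_add_le (w 0 - z) z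
    linarith [hεs 0]
  have hzpos : 0 < ‖z‖ := by linarith
  refine ⟨‖z‖⁻¹ • z, ?_, fun i => ⟨(s i).1.1, (s i).2.1.mem_integerPoints,
    (s i).2.1.linearIndependent, ?_, ?_⟩⟩
  · rw [norm_smul, norm_inv, norm_norm, inv_mul_cancel₀ hzpos.ne']
  · intro j
    refine ((s i).2.1.norm_le j).trans ?_
    rw [Real.exp_add, mul_comm]
    gcongr
    have := Real.add_one_le_exp ((n : ℝ) + 2)
    have : (0 : ℝ) ≤ n := Nat.cast_nonneg n
    linarith
  · intro j
    set x := (s i).1.1 with hx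
    set a := labelSize δ (r i) with ha
    have hred : IsReduced a (k i) x (s i).1.2.1 := (s i).2.1
    have e1 : |inner ℝ (w i) (x j)| ≤ 2 * 2 ^ n * Real.exp (a j - q i) := by
      rcases eq_or_ne j (k i) with rfl | hj
      · refine (hred.abs_inner_le (labelSize_injective hδ0 _) (w i) (s i).2.2).trans ?_
        gcongr
        linarith [hw2 i, hεpos i]
      · rw [(s i).2.2 j hj, abs_zero]
        positivity
    have e2 : |inner ℝ (w i - z) (x j)| ≤ 2 ^ n * Real.exp (a j - q i) := by
      calc |inner ℝ (w i - z) (x j)| ≤ ‖w i - z‖ * ‖x j‖ := abs_real_inner_le_norm _ _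
        _ ≤ (4 * ε (i + 1)) * (2 * Real.exp (a j)) := by
          gcongr
          · exact hwz i
          · exact hred.norm_le j
        _ = 64 * (10 ^ n * Real.exp (-(n * δ))) * (Real.exp (a j) * Real.exp (-q i)) := by
          simp only [hε, hqs, neg_add, Real.exp_add]
          ring
        _ ≤ 64 * (1 / 100) * (Real.exp (a j) * Real.exp (-q i)) := by gcongr
        _ ≤ 2 ^ n * (Real.exp (a j) * Real.exp (-q i)) := by
          gcongr
          linarith [one_le_pow₀ (by norm_num : (1 : ℝ) ≤ 2) (n := n)]
        _ = _ := by rw [← Real.exp_add]; rfl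
    have e3 : |inner ℝ z (x j)| ≤ 3 * 2 ^ n * Real.exp (a j - q i) := by
      have : inner ℝ z (x j) = inner ℝ (w i) (x j) - inner ℝ (w i - z) (x j) := by
        rw [inner_sub_left]
        ring
      rw [this]
      refine (abs_sub _ _).trans ?_
      linarith
    have e4 : 6 * 2 ^ n ≤ Real.exp (n + 2) := by
      have e5 : (2.7 : ℝ) ≤ Real.exp 1 := by linarith [Real.exp_one_gt_d9]
      have e6 : Real.exp ((n : ℝ) + 2) = Real.exp 1 ^ n * Real.exp 1 ^ 2 := by
        rw [Real.exp_add, ← Real.exp_nat_mul, ← Real.exp_nat_mul]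
        norm_num
      rw [e6]
      calc (6 : ℝ) * 2 ^ n ≤ 2 ^ n * 2.7 ^ 2 := by
            have : (0 : ℝ) < 2 ^ n := by positivity
            nlinarith
        _ ≤ _ := by gcongr; linarith
    rw [real_inner_smul_right, abs_mul, abs_inv, abs_norm, real_inner_comm, inv_mul_le_iff₀ hzpos]
    calc |inner ℝ z (x j)| ≤ 3 * 2 ^ n * Real.exp (a j - q i) := e3
      _ = 1 / 2 * (6 * 2 ^ n * Real.exp (a j - q i)) := by ring
      _ ≤ ‖z‖ * (Real.exp (n + 2) * Real.exp (a j - q i)) := by gcongr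
      _ = _ := by
        rw [← Real.exp_add]
        congr 2
        ring

end

/-! ### Successive minima -/

section

variable {n : ℕ}

theorem succMin_mono {u : EuclideanSpace ℝ (Fin n)} (hu : ‖u‖ = 1) {q q' : ℝ} (hq : 0 ≤ q)
    (hqq' : q ≤ q') (j : Fin n) : succMin u q j ≤ succMin u q' j := by
  refine (isLeast_succMin u hu q hq j).2 ?_
  obtain ⟨h0, x, hx, h⟩ := (isLeast_succMin u hu q' (hq.trans hqq') j).1
  refine ⟨h0, x, hx, fun i => ⟨(h i).1, ?_⟩⟩
  have h2 := (h i).2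
  rw [mem_exp_smul_convexBody] at h2 ⊢
  exact ⟨h2.1, h2.2.trans (Real.exp_le_exp.2 (by linarith))⟩

theorem succMin_le_add {u : EuclideanSpace ℝ (Fin n)} (hu : ‖u‖ = 1) {q q' : ℝ} (hq : 0 ≤ q)
    (hqq' : q ≤ q') (j : Fin n) : succMin u q' j ≤ succMin u q j + (q' - q) := by
  refine (isLeast_succMin u hu q' (hq.trans hqq') j).2 ?_
  obtain ⟨h0, x, hx, h⟩ := (isLeast_succMin u hu q hq j).1
  refine ⟨by linarith, x, hx, fun i => ⟨(h i).1, ?_⟩⟩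
  have h2 := (h i).2
  rw [mem_exp_smul_convexBody] at h2 ⊢
  exact ⟨h2.1.trans (Real.exp_le_exp.2 (by linarith)),
    h2.2.trans (Real.exp_le_exp.2 (by linarith))⟩

theorem abs_succMin_sub_le {u : EuclideanSpace ℝ (Fin n)} (hu : ‖u‖ = 1) {q q' : ℝ} (hq : 0 ≤ q)
    (hq' : 0 ≤ q') (j : Fin n) : |succMin u q j - succMin u q' j| ≤ |q - q'| := by
  rcases le_total q q' with h | h
  · have h1 := succMin_mono hu hq h j
    have h2 := succMin_le_add hu hq h j
    rw [abs_sub_comm, abs_of_nonneg (by linarith), abs_sub_comm, abs_of_nonneg (by linarith)]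
    linarith
  · have h1 := succMin_mono hu hq' h j
    have h2 := succMin_le_add hu hq' h j
    rw [abs_of_nonneg (by linarith), abs_of_nonneg (by linarith)]
    linarith

/-- Among `j + 1` linearly independent vectors, one can take the place of some `x m` that is not
among the first `j` vectors of a given ordering of a basis `x`. -/
theorem exists_exchange {x : Fin n → EuclideanSpace ℝ (Fin n)} (hx : LinearIndependent ℝ x)
    (σ : Equiv.Perm (Fin n)) (j : Fin n) {z : Fin (j + 1) → EuclideanSpace ℝ (Fin n)}
    (hz : LinearIndependent ℝ z) :
    ∃ i, ∃ m, j ≤ m ∧ coordDet (Function.update x (σ m) (z i)) ≠ 0 := by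
  have hspan := hx.span_eq_top_of_card_eq_finrank' (by simp)
  have hrep : ∀ i, ∃ c : Fin n → ℝ, ∑ p, c p • x p = z i := fun i =>
    (Submodule.mem_span_range_iff_exists_fun ℝ).1 (hspan ▸ Submodule.mem_top)
  choose c hc using hrep
  have hdet : ∀ i p, coordDet (Function.update x p (z i)) = c i p * coordDet x := by
    intro i p
    rw [← hc i, coordDet, AlternatingMap.map_update_sum]
    simp only [AlternatingMap.map_update_smul]
    rw [Finset.sum_eq_single_of_mem p (Finset.mem_univ p), Function.update_eq_self]
    · rfl
    · intro p' _ hp'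
      rw [AlternatingMap.map_update_self _ _ hp'.symm, smul_zero]
  have hx0 := (coordDet_ne_zero_iff x).2 hx
  by_contra! hcon
  have hc0 : ∀ i m, j ≤ m → c i (σ m) = 0 := by
    intro i m hm
    have := hcon i m hm
    rw [hdet] at this
    exact (mul_eq_zero.1 this).resolve_right hx0
  set W := Submodule.span ℝ ((fun m => x (σ m)) '' (Finset.Iio j : Finset (Fin n)))
  have hzW : ∀ i, z i ∈ W := by
    intro i
    rw [← hc i, ← Equiv.sum_comp σ]
    refine Submodule.sum_mem _ fun m _ => ?_
    rcases lt_or_ge m j with hm | hm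
    · exact Submodule.smul_mem _ _ (Submodule.subset_span ⟨m, by simpa using hm, rfl⟩)
    · rw [hc0 i m hm, zero_smul]
      exact Submodule.zero_mem _
  have h1 : Module.finrank ℝ W ≤ j := by
    classical
    have := finrank_span_finset_le_card (R := ℝ) ((Finset.Iio j).image fun m => x (σ m))
    rw [Finset.coe_image] at this
    exact this.trans (Finset.card_image_le.trans (by simp))
  have h2 : LinearIndependent ℝ fun i => (⟨z i, hzW i⟩ : W) :=
    LinearIndependent.of_comp W.subtype hz
  have h3 := h2.fintype_card_le_finrank
  simp at h3
  omega

/-- If linearly independent integer points `x j` have logarithmic sizes at most `a j + c` with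
respect to the convex body at `q = ∑ j, a j`, then the successive minima are the `a j` up to a
constant. -/
theorem abs_succMin_sub_le_of_basis {u : EuclideanSpace ℝ (Fin n)} (hu : ‖u‖ = 1) {a : Fin n → ℝ}
    (ha : ∀ j, 0 ≤ a j) {c : ℝ} (hc : 0 ≤ c) {x : Fin n → EuclideanSpace ℝ (Fin n)}
    (hint : ∀ j, x j ∈ integerPoints n) (hx : LinearIndependent ℝ x)
    (h1 : ∀ j, ‖x j‖ ≤ Real.exp (a j + c))
    (h2 : ∀ j, |inner ℝ (x j) u| ≤ Real.exp (a j + c - ∑ m, a m))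
    (σ : Equiv.Perm (Fin n)) (hσ : Monotone (a ∘ σ)) (j : Fin n) :
    |succMin u (∑ m, a m) j - a (σ j)| ≤ n * c + n := by
  have hn : (1 : ℝ) ≤ n := by exact_mod_cast j.pos
  have hq : 0 ≤ ∑ m, a m := Finset.sum_nonneg fun m _ => ha m
  have hL := isLeast_succMin u hu (∑ m, a m) hq j
  have hnc : c ≤ n * c := le_mul_of_one_le_left hc hn
  rw [abs_le]
  constructor
  -- replacing a suitable `x (σ m)`, `j ≤ m`, by a point `z i` realizing the minimum gives `n`
  -- independent integer points, whose sizes add up to at least about `∑ m, a m`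
  · obtain ⟨-, z, hz, hzK⟩ := hL.1
    obtain ⟨i, m, hjm, hdet⟩ := exists_exchange hx σ j hz
    set L := succMin u (∑ m, a m) j
    have hzi := (mem_exp_smul_convexBody u (z i) _ L).1 (hzK i).2
    have key := le_sum_add_of_integerPoints u hu (∑ m, a m) hq
      (Function.update x (σ m) (z i)) (Function.update (fun p => a p + c) (σ m) L) (by
        intro p
        rcases eq_or_ne p (σ m) with rfl | hp
        · rw [Function.update_self]
          exact (hzK i).1
        · rw [Function.update_of_ne hp]
          exact hint p) hdet (by
        intro p
        rcases eq_or_ne p (σ m) with rfl | hp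
        · rw [Function.update_self, Function.update_self]
          exact hzi.1
        · rw [Function.update_of_ne hp, Function.update_of_ne hp]
          exact h1 p) (by
        intro p
        rcases eq_or_ne p (σ m) with rfl | hp
        · rw [Function.update_self, Function.update_self]
          exact hzi.2
        · rw [Function.update_of_ne hp, Function.update_of_ne hp]
          exact h2 p)
    rw [Finset.sum_update_of_mem (Finset.mem_univ _), ← Finset.erase_eq] at key
    have e1 := Finset.add_sum_erase Finset.univ (fun p => a p + c) (Finset.mem_univ (σ m))
    have e3 : ∑ p, (a p + c) = ∑ p, a p + n * c := by simp [Finset.sum_add_distrib]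
    have e2 : a (σ j) ≤ a (σ m) := hσ hjm
    linarith
  · have : a (σ j) + c ∈ admissible u (∑ m, a m) (j + 1) := by
      refine ⟨add_nonneg (ha _) hc, fun i => x (σ (Fin.castLE j.2 i)), ?_, fun i => ⟨hint _, ?_⟩⟩
      · exact hx.comp _ (σ.injective.comp (Fin.castLE_injective _))
      · rw [mem_exp_smul_convexBody]
        have hle : a (σ (Fin.castLE j.2 i)) ≤ a (σ j) :=
          hσ (Fin.le_def.2 (Nat.lt_succ_iff.1 i.2))
        exact ⟨(h1 _).trans (Real.exp_le_exp.2 (by linarith)),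
          (h2 _).trans (Real.exp_le_exp.2 (by linarith))⟩
    have := hL.2 this
    linarith

end

/-! ### Analysis of `(n, 0)`-systems -/

section

section Slopes

variable {f : ℝ → ℝ} {s c q b : ℝ}

theorem HasLeftSlope.le_of_forall_le (h : HasLeftSlope f s q) (hb : b < q)
    (hf : ∀ y ∈ Set.Ioo b q, f y ≤ f q - c * (q - y)) : c ≤ s := by
  rw [HasLeftSlope, hasDerivWithinAt_iff_tendsto_slope, Set.Iic_sdiff_right] at h
  refine ge_of_tendsto h ?_
  filter_upwards [Ioo_mem_nhdsLT hb] with y hy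
  rw [slope_def_field, le_div_iff_of_neg (by linarith [hy.2])]
  linarith [hf y hy]

theorem HasRightSlope.le_of_forall_le (h : HasRightSlope f s q) (hb : q < b)
    (hf : ∀ y ∈ Set.Ioo q b, f y ≤ f q + c * (y - q)) : s ≤ c := by
  rw [HasRightSlope, hasDerivWithinAt_iff_tendsto_slope, Set.Ici_sdiff_left] at h
  refine le_of_tendsto h ?_
  filter_upwards [Ioo_mem_nhdsGT hb] with y hy
  rw [slope_def_field, div_le_iff₀ (by linarith [hy.1])]
  linarith [hf y hy]

theorem HasLeftSlope.exists_forall_abs_le (h : HasLeftSlope f s q) {ε : ℝ} (hε : 0 < ε) :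
    ∃ b < q, ∀ y ∈ Set.Ioo b q, |f q - f y - s * (q - y)| ≤ ε * (q - y) := by
  rw [HasLeftSlope, hasDerivWithinAt_iff_tendsto_slope, Set.Iic_sdiff_right] at h
  have h2 := h (Metric.closedBall_mem_nhds s hε)
  obtain ⟨b, hb, hb'⟩ := mem_nhdsLT_iff_exists_Ioo_subset.1 h2
  refine ⟨b, hb, fun y hy => ?_⟩
  have h3 := hb' hy
  rw [Set.mem_preimage, Metric.mem_closedBall, Real.dist_eq, slope_def_field] at h3
  have hqy : 0 < q - y := by linarith [hy.2]
  have e : f q - f y - s * (q - y) = ((f y - f q) / (y - q) - s) * (q - y) := by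
    have : y - q ≠ 0 := by linarith
    field_simp
    ring
  rw [e, abs_mul, abs_of_pos hqy]
  gcongr

end Slopes

variable {n : ℕ} {q₀ : ℝ} {P : ℝ → Fin n → ℝ}

namespace IsSystem

theorem monotone_apply (hP : IsSystem n 0 q₀ P) {q : ℝ} (hq : q₀ ≤ q) : Monotone (P q) := by
  have key : ∀ d : ℕ, ∀ i j : Fin n, (i : ℕ) + d = j → P q i ≤ P q j := by
    intro d
    induction d with
    | zero =>
      intro i j h
      rw [Fin.ext h]
    | succ d ih =>
      intro i j h
      have hj := j.2
      have h1 := ih i ⟨i + d, by omega⟩ rfl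
      have h2 := (hP.S1 ⟨i + d, by omega⟩ j (by simp only; omega) q hq).2
      linarith
  intro i j hij
  exact key (j - i) i j (Nat.add_sub_of_le hij)

theorem nonneg (hP : IsSystem n 0 q₀ P) (hn : 2 ≤ n) {q : ℝ} (hq : q₀ ≤ q) (j : Fin n) :
    0 ≤ P q j := by
  have h1 := (hP.S1 ⟨0, by omega⟩ ⟨1, by omega⟩ rfl q hq).1
  have h2 := hP.monotone_apply hq (Fin.mk_le_of_le_val (Nat.zero_le j) : (⟨0, by omega⟩ : Fin n) ≤ j)
  linarith

theorem mono (hP : IsSystem n 0 q₀ P) {q q' : ℝ} (hq : q₀ ≤ q) (hqq' : q ≤ q') (j : Fin n) :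
    P q j ≤ P q' j := by
  simpa using hP.S2 j q q' hq hqq'

theorem partialSum_succ (P : ℝ → Fin n → ℝ) {i j : Fin n} (hij : (i : ℕ) + 1 = j) (q : ℝ) :
    partialSum P j q = partialSum P i q + P q j := by
  have h : Finset.Iic j = insert j (Finset.Iic i) := by
    ext m
    simp only [Finset.mem_Iic, Finset.mem_insert, Fin.le_def, Fin.ext_iff]
    omega
  rw [partialSum, h, Finset.sum_insert (fun h => by
    rw [Finset.mem_Iic, Fin.le_def] at h
    omega), add_comm]
  rfl

theorem partialSum_add_sum_Ioi (hP : IsSystem n 0 q₀ P) {q : ℝ} (hq : q₀ ≤ q) (i : Fin n) :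
    partialSum P i q + ∑ j ∈ Finset.Ioi i, P q j = q := by
  refine Eq.trans ?_ (hP.S4 q hq)
  rw [partialSum, ← Finset.sum_union]
  · congr 1
    ext m
    simp [le_or_gt]
  · rw [Finset.disjoint_left]
    intro m h1 h2
    exact absurd (Finset.mem_Iic.1 h1) (Finset.mem_Ioi.1 h2).not_ge

theorem sub_le_partialSum_sub (hP : IsSystem n 0 q₀ P) {q q' : ℝ} (hq : q₀ ≤ q) (hqq' : q ≤ q')
    {i j : Fin n} (hj : j ≤ i) : P q' j - P q j ≤ partialSum P i q' - partialSum P i q := by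
  rw [partialSum, partialSum, ← Finset.sum_sub_distrib]
  exact Finset.single_le_sum (f := fun j => P q' j - P q j)
    (fun m _ => sub_nonneg.2 (hP.mono hq hqq' m)) (Finset.mem_Iic.2 hj)

theorem partialSum_mono (hP : IsSystem n 0 q₀ P) {q q' : ℝ} (hq : q₀ ≤ q) (hqq' : q ≤ q')
    (i : Fin n) : partialSum P i q ≤ partialSum P i q' :=
  Finset.sum_le_sum fun m _ => hP.mono hq hqq' m

theorem partialSum_sub_add_le (hP : IsSystem n 0 q₀ P) {q q' : ℝ} (hq : q₀ ≤ q) (hqq' : q ≤ q')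
    {i j : Fin n} (hj : i < j) :
    partialSum P i q' - partialSum P i q + (P q' j - P q j) ≤ q' - q := by
  have h1 := hP.partialSum_add_sum_Ioi hq i
  have h2 := hP.partialSum_add_sum_Ioi (hq.trans hqq') i
  have h3 := Finset.single_le_sum (f := fun j => P q' j - P q j)
    (fun m _ => sub_nonneg.2 (hP.mono hq hqq' m)) (Finset.mem_Ioi.2 hj)
  rw [Finset.sum_sub_distrib] at h3
  linarith

theorem partialSum_sub_le (hP : IsSystem n 0 q₀ P) {q q' : ℝ} (hq : q₀ ≤ q) (hqq' : q ≤ q')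
    (i : Fin n) : partialSum P i q' - partialSum P i q ≤ q' - q := by
  have h1 := hP.partialSum_add_sum_Ioi hq i
  have h2 := hP.partialSum_add_sum_Ioi (hq.trans hqq') i
  have h3 : ∑ j ∈ Finset.Ioi i, P q j ≤ ∑ j ∈ Finset.Ioi i, P q' j :=
    Finset.sum_le_sum fun m _ => hP.mono hq hqq' m
  linarith

theorem sub_le (hP : IsSystem n 0 q₀ P) {q q' : ℝ} (hq : q₀ ≤ q) (hqq' : q ≤ q') (j : Fin n) :
    P q' j - P q j ≤ q' - q :=
  (hP.sub_le_partialSum_sub hq hqq' le_rfl).trans (hP.partialSum_sub_le hq hqq' j)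

/-- As long as `P i` stays below its successor, the sum `P 0 + ⋯ + P i` is convex: where its graph is
highest above a chord, the slope would have to change from `1` to `0`. -/
theorem partialSum_le_chord (hP : IsSystem n 0 q₀ P) {i j : Fin n} (hij : (i : ℕ) + 1 = j)
    {a b : ℝ} (ha : q₀ ≤ a) (hlt : ∀ q ∈ Set.Ioo a b, P q i < P q j) {y : ℝ}
    (hy : y ∈ Set.Icc a b) :
    (partialSum P i y - partialSum P i a) * (b - a) ≤
      (partialSum P i b - partialSum P i a) * (y - a) := by
  set M := partialSum P i with hM
  rcases (hy.1.trans hy.2).eq_or_lt with rfl | hab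
  · obtain rfl : y = a := le_antisymm hy.2 hy.1
    simp
  have hba : 0 < b - a := sub_pos.2 hab
  set c := (M b - M a) / (b - a) with hc
  have hcb : c * (b - a) = M b - M a := div_mul_cancel₀ _ hba.ne'
  by_contra! hcon
  have hcont : ContinuousOn (fun z => M z - c * z) (Set.Icc a b) :=
    (((hP.S3 i).continuousOn.mono fun z hz => ha.trans hz.1)).sub (by fun_prop)
  obtain ⟨z, hz, hmax⟩ := isCompact_Icc.exists_isMaxOn ⟨a, Set.left_mem_Icc.2 hab.le⟩ hcont
  have hmax' : ∀ w ∈ Set.Icc a b, M w - c * w ≤ M z - c * z := fun w hw => hmax hw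
  have hypos : M a - c * a < M y - c * y := by
    rw [← hcb] at hcon
    nlinarith
  have hzpos : M a - c * a < M z - c * z := hypos.trans_le (hmax' y hy)
  have haz : a < z := lt_of_le_of_ne hz.1 (by rintro rfl; exact lt_irrefl _ hzpos)
  have hzb : z < b := lt_of_le_of_ne hz.2 (by
    rintro rfl
    nlinarith)
  have hMz0 : M a ≤ M z := hP.partialSum_mono ha haz.le i
  have hMzb : M z ≤ M b := hP.partialSum_mono (ha.trans haz.le) hzb.le i
  have hMz1 : M z - M a ≤ z - a := hP.partialSum_sub_le ha haz.le i
  have hMzb1 : M b - M z ≤ b - z := hP.partialSum_sub_le (ha.trans haz.le) hzb.le i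
  have hleft : HasLeftSlope M 1 z := by
    refine ((hP.S3 i).left z (ha.trans_lt haz)).resolve_left fun h => ?_
    have hc0 : c ≤ 0 := h.le_of_forall_le haz fun w hw => by
      linarith [hmax' w ⟨hw.1.le, hw.2.le.trans hz.2⟩]
    nlinarith
  have hright : HasRightSlope M 0 z := by
    refine ((hP.S3 i).right z (ha.trans haz.le)).resolve_right fun h => ?_
    have hc1 : 1 ≤ c := h.le_of_forall_le hzb fun w hw => by
      linarith [hmax' w ⟨hz.1.trans hw.1.le, hw.2.le⟩]
    nlinarith
  have h5 := hP.S5 i j hij z (ha.trans_lt haz) hleft hright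
  have h6 := hlt z ⟨haz, hzb⟩
  linarith

/-- Just before any time, only one component of the system varies. -/
theorem exists_forall_ne_eq (hP : IsSystem n 0 q₀ P) (hn : 2 ≤ n) {s : ℝ} (hs : q₀ < s) :
    ∃ p, q₀ ≤ p ∧ p < s ∧ ∃ m, ∀ j, j ≠ m → P p j = P s j := by
  -- the component that varies is the first `m` whose partial sum has left derivative `1`
  have htop : HasLeftSlope (partialSum P ⟨n - 1, by omega⟩) 1 s := by
    refine ((hP.S3 _).left s hs).resolve_left fun h => ?_
    have htopeq : ∀ q, q₀ ≤ q → partialSum P ⟨n - 1, by omega⟩ q = q := by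
      intro q hq
      refine Eq.trans ?_ (hP.S4 q hq)
      rw [partialSum]
      congr 1
      ext m
      simp only [Finset.mem_Iic, Finset.mem_univ, iff_true, Fin.le_def]
      omega
    have : (1 : ℝ) ≤ 0 := h.le_of_forall_le hs fun y hy => by
      rw [htopeq y hy.1.le, htopeq s hs.le]
      linarith
    linarith
  obtain ⟨m, hm, hmin⟩ := WellFounded.has_min (wellFounded_lt (α := Fin n))
    {m | HasLeftSlope (partialSum P m) 1 s} ⟨_, htop⟩
  have hm : HasLeftSlope (partialSum P m) 1 s := hm
  have hlow : ∀ i, i < m → HasLeftSlope (partialSum P i) 0 s := fun i hi =>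
    ((hP.S3 i).left s hs).resolve_right fun h => hmin i h hi
  -- `P m` drops by at least half of the elapsed time, the components above by at most a quarter
  obtain ⟨b₁, hb₁, hD⟩ := hm.exists_forall_abs_le (ε := 1 / 4) (by norm_num)
  have hD' : ∀ q ∈ Set.Ioo b₁ s,
      3 / 4 * (s - q) ≤ partialSum P m s - partialSum P m q := by
    intro q hq
    have := (abs_le.1 (hD q hq)).1
    linarith
  have hlow' : ∃ b₂ < s, ∀ q ∈ Set.Ioo b₂ s, q₀ < q → 1 / 2 * (s - q) ≤ P s m - P q m ∧
      ∀ i : Fin n, (i : ℕ) + 1 = m → P s i - P q i ≤ 1 / 4 * (s - q) := by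
    rcases Nat.eq_zero_or_pos (m : ℕ) with h0 | h0
    · refine ⟨b₁, hb₁, fun q hq _ => ⟨?_, fun i hi => by omega⟩⟩
      have e : ∀ q, partialSum P m q = P q m := by
        intro q
        have : Finset.Iic m = {m} := by
          ext j
          simp only [Finset.mem_Iic, Finset.mem_singleton, Fin.le_def, Fin.ext_iff]
          omega
        rw [partialSum, this, Finset.sum_singleton]
      have := hD' q hq
      rw [e, e] at this
      linarith [hq.2]
    · obtain ⟨i, hi⟩ : ∃ i : Fin n, (i : ℕ) + 1 = m := ⟨⟨m - 1, by omega⟩, by simp only; omega⟩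
      have him : i < m := by rw [Fin.lt_def]; omega
      obtain ⟨b₂, hb₂, hE⟩ := (hlow i him).exists_forall_abs_le (ε := 1 / 4) (by norm_num)
      refine ⟨max b₁ b₂, max_lt hb₁ hb₂, fun q hq hqq => ?_⟩
      have h1 := hD' q ⟨(le_max_left _ _).trans_lt hq.1, hq.2⟩
      have h2 := (abs_le.1 (hE q ⟨(le_max_right _ _).trans_lt hq.1, hq.2⟩)).2
      have h3 := partialSum_succ P hi s
      have h4 := partialSum_succ P hi q
      refine ⟨by linarith, fun i' hi' => ?_⟩
      obtain rfl : i' = i := Fin.ext (by omega)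
      have h5 := hP.sub_le_partialSum_sub hqq.le hq.2.le (le_refl i')
      linarith
  obtain ⟨b₂, hb₂, hE⟩ := hlow'
  have hupper : ∃ p, q₀ ≤ p ∧ p < s ∧ ∀ j, m < j → P p j = P s j := by
    by_cases hmtop : (m : ℕ) + 1 = n
    · refine ⟨q₀, le_rfl, hs, fun j hj => ?_⟩
      have := j.2
      rw [Fin.lt_def] at hj
      omega
    obtain ⟨m', hm'⟩ : ∃ m' : Fin n, (m : ℕ) + 1 = m' :=
      ⟨⟨m + 1, by have := m.2; omega⟩, rfl⟩
    have hmm' : m < m' := by rw [Fin.lt_def]; omega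
    set b := max q₀ (max b₁ b₂) with hb
    have hbs : b < s := max_lt hs (max_lt hb₁ hb₂)
    have hq₀b : q₀ ≤ b := le_max_left _ _
    have hstrict : ∀ q ∈ Set.Ioo b s, P q m < P q m' := by
      intro q hq
      have hqq : q₀ < q := hq₀b.trans_lt hq.1
      have hqb : max b₁ b₂ < q := (le_max_right _ _).trans_lt hq.1
      have h1 := hD' q ⟨(le_max_left _ _).trans_lt hqb, hq.2⟩
      have h2 := (hE q ⟨(le_max_right _ _).trans_lt hqb, hq.2⟩ hqq).1
      have h3 := hP.partialSum_sub_add_le hqq.le hq.2.le hmm'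
      have h4 := hP.monotone_apply hs.le hmm'.le
      linarith [hq.2]
    obtain ⟨p, hp, hpD⟩ : ∃ p ∈ Set.Ioo b s, partialSum P m s - partialSum P m p = s - p := by
      by_contra! hcon
      obtain ⟨p, hp⟩ := exists_between hbs
      have hconst := constant_of_has_deriv_right_zero (f := partialSum P m) (a := p) (b := s)
        ((hP.S3 m).continuousOn.mono fun z hz => hq₀b.trans (hp.1.le.trans hz.1)) (by
          intro q hq
          have hqb : b < q := hp.1.trans_le hq.1
          have hqq : q₀ ≤ q := hq₀b.trans hqb.le
          refine ((hP.S3 m).right q hqq).resolve_right fun h => ?_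
          have hlt : partialSum P m s - partialSum P m q < s - q :=
            lt_of_le_of_ne (hP.partialSum_sub_le hqq hq.2.le m) (hcon q ⟨hqb, hq.2⟩)
          have hsq : 0 < s - q := sub_pos.2 hq.2
          have h1 : 1 ≤ (partialSum P m s - partialSum P m q) / (s - q) :=
            h.le_of_forall_le hq.2 fun y hy => by
              have := hP.partialSum_le_chord hm' hqq
                (fun z hz => hstrict z ⟨hqb.trans hz.1, hz.2⟩) ⟨hy.1.le, hy.2.le⟩
              rw [← sub_le_iff_le_add', div_mul_eq_mul_div, le_div_iff₀ hsq]
              exact this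
          rw [le_div_iff₀ hsq] at h1
          linarith) s (Set.right_mem_Icc.2 hp.2.le)
      have := hD' p ⟨(le_max_left _ _).trans_lt ((le_max_right _ _).trans_lt hp.1), hp.2⟩
      linarith [hp.2]
    have hpq : q₀ ≤ p := hq₀b.trans hp.1.le
    refine ⟨p, hpq, hp.2, fun j hj => ?_⟩
    have h1 := hP.partialSum_sub_add_le hpq hp.2.le hj
    have h2 := hP.mono hpq hp.2.le j
    linarith
  have hlower : ∃ p, q₀ ≤ p ∧ p < s ∧ ∀ j, j < m → P p j = P s j := by
    rcases Nat.eq_zero_or_pos (m : ℕ) with h0 | h0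
    · refine ⟨q₀, le_rfl, hs, fun j hj => ?_⟩
      rw [Fin.lt_def] at hj
      omega
    obtain ⟨i, hi⟩ : ∃ i : Fin n, (i : ℕ) + 1 = m := ⟨⟨m - 1, by omega⟩, by simp only; omega⟩
    have him : i < m := by rw [Fin.lt_def]; omega
    have hgap : P s i < P s m := by
      obtain ⟨q, hq⟩ := exists_between (max_lt hs hb₂)
      have hqq : q₀ < q := (le_max_left _ _).trans_lt hq.1
      obtain ⟨h1, h2⟩ := hE q ⟨(le_max_right _ _).trans_lt hq.1, hq.2⟩ hqq
      have h3 := h2 i hi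
      have h4 := hP.monotone_apply hqq.le him.le
      linarith [hq.2]
    set p := max q₀ (s - (P s m - P s i)) with hp
    have hps : p < s := max_lt hs (by linarith)
    have hpq : q₀ ≤ p := le_max_left _ _
    have hstrict : ∀ q ∈ Set.Ioo p s, P q i < P q m := by
      intro q hq
      have hqq : q₀ ≤ q := hpq.trans hq.1.le
      have h1 := hP.mono hqq hq.2.le i
      have h2 := hP.sub_le hqq hq.2.le m
      have h3 : s - (P s m - P s i) < q := (le_max_right _ _).trans_lt hq.1
      linarith
    have hsp : 0 < s - p := sub_pos.2 hps
    have hzero : (partialSum P i s - partialSum P i p) / (s - p) ≤ 0 :=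
      (hlow i him).le_of_forall_le hps fun y hy => by
        have h1 := hP.partialSum_le_chord hi hpq hstrict ⟨hy.1.le, hy.2.le⟩
        have h2 : (partialSum P i s - partialSum P i p) / (s - p) * (s - y) ≤
            partialSum P i s - partialSum P i y := by
          rw [div_mul_eq_mul_div, div_le_iff₀ hsp]
          linarith
        linarith
    rw [div_le_iff₀ hsp, zero_mul] at hzero
    refine ⟨p, hpq, hps, fun j hj => ?_⟩
    have h1 := hP.sub_le_partialSum_sub hpq hps.le (i := i) (j := j) (by
      rw [Fin.le_def]
      rw [Fin.lt_def] at hj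
      omega)
    have h2 := hP.mono hpq hps.le j
    linarith
  obtain ⟨p₁, hp₁, hp₁s, h₁⟩ := hupper
  obtain ⟨p₂, hp₂, hp₂s, h₂⟩ := hlower
  refine ⟨max p₁ p₂, hp₁.trans (le_max_left _ _), max_lt hp₁s hp₂s, m, fun j hj => ?_⟩
  have hle := hP.mono (hp₁.trans (le_max_left p₁ p₂)) (max_lt hp₁s hp₂s).le j
  rcases lt_or_gt_of_ne hj with hj | hj
  · have := hP.mono hp₂ (le_max_right p₁ p₂) j
    linarith [h₂ j hj]
  · have := hP.mono hp₁ (le_max_left p₁ p₂) j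
    linarith [h₁ j hj]

end IsSystem

end

/-! ### Discretization of `(n, 0)`-systems -/

section

variable {n : ℕ} {q₀ : ℝ} {P : ℝ → Fin n → ℝ}

/-- The numbers of multiples of `Δ` passed by the components of `P`. -/
noncomputable def levels (Δ : ℝ) (P : ℝ → Fin n → ℝ) (q : ℝ) (j : Fin n) : ℕ := ⌊P q j / Δ⌋₊

theorem exists_eq_update_of_sum_eq {f g : Fin n → ℕ} (hfg : f ≤ g)
    (hsum : ∑ j, g j = ∑ j, f j + 1) : ∃ j, g = Function.update f j (f j + 1) := by
  obtain ⟨j, -, hj⟩ := Finset.exists_lt_of_sum_lt (s := Finset.univ) (f := f) (g := g) (by omega)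
  refine ⟨j, ?_⟩
  have hle : Function.update f j (f j + 1) ≤ g := by
    intro i
    rcases eq_or_ne i j with rfl | hi
    · simpa using hj
    · simpa [hi] using hfg i
  have hs : ∑ i, Function.update f j (f j + 1) i = ∑ i, g i := by
    rw [hsum, Finset.sum_update_of_mem (Finset.mem_univ j),
      ← Finset.add_sum_erase Finset.univ f (Finset.mem_univ j), Finset.erase_eq]
    ring
  funext i
  exact ((Finset.sum_eq_sum_iff_of_le fun i _ => hle i).1 hs i (Finset.mem_univ i)).symm

namespace IsSystem

theorem levels_mono (hP : IsSystem n 0 q₀ P) {Δ : ℝ} (hΔ : 0 < Δ) {q q' : ℝ} (hq : q₀ ≤ q)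
    (hqq' : q ≤ q') : levels Δ P q ≤ levels Δ P q' := fun j =>
  Nat.floor_mono (div_le_div_of_nonneg_right (hP.mono hq hqq' j) hΔ.le)

theorem levels_monotone (hP : IsSystem n 0 q₀ P) {Δ : ℝ} (hΔ : 0 < Δ) {q : ℝ} (hq : q₀ ≤ q) :
    Monotone (levels Δ P q) := fun _ _ hij =>
  Nat.floor_mono (div_le_div_of_nonneg_right (hP.monotone_apply hq hij) hΔ.le)

theorem lt_of_levels_lt {Δ : ℝ} (hΔ : 0 < Δ) {q q' : ℝ} {i j : Fin n}
    (h : levels Δ P q i < levels Δ P q' j) : P q i < P q' j := by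
  by_contra! hcon
  exact absurd (Nat.floor_mono (div_le_div_of_nonneg_right hcon hΔ.le)) h.not_ge

theorem levels_mul_le (hP : IsSystem n 0 q₀ P) (hn : 2 ≤ n) {Δ : ℝ} (hΔ : 0 < Δ) {q : ℝ}
    (hq : q₀ ≤ q) (j : Fin n) : Δ * levels Δ P q j ≤ P q j := by
  have := Nat.floor_le (div_nonneg (hP.nonneg hn hq j) hΔ.le)
  rw [le_div_iff₀ hΔ] at this
  rw [mul_comm]
  exact this

theorem lt_levels_mul_add {Δ : ℝ} (hΔ : 0 < Δ) (q : ℝ) (j : Fin n) :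
    P q j < Δ * levels Δ P q j + Δ := by
  have := Nat.lt_floor_add_one (P q j / Δ)
  rw [div_lt_iff₀ hΔ] at this
  calc P q j < _ := this
    _ = _ := by rw [levels]; ring

theorem eventually_levels_eq (hP : IsSystem n 0 q₀ P) {Δ : ℝ} (hΔ : 0 < Δ) {s : ℝ} (hs : q₀ ≤ s) :
    ∃ b, s < b ∧ ∀ q, s ≤ q → q < b → levels Δ P q = levels Δ P s := by
  have hev : ∀ᶠ q in nhdsWithin s (Set.Ici s), ∀ j, levels Δ P q j = levels Δ P s j := by
    rw [Filter.eventually_all]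
    intro j
    have hgap := lt_levels_mul_add (P := P) hΔ s j
    have hlt : s < s + (Δ * levels Δ P s j + Δ - P s j) := by linarith
    filter_upwards [Ico_mem_nhdsGE hlt] with q hq
    refine le_antisymm ?_ (hP.levels_mono hΔ hs hq.1 j)
    have h1 := hP.sub_le hs hq.1 j
    have h2 : P q j / Δ < (levels Δ P s j + 1 : ℕ) := by
      rw [div_lt_iff₀ hΔ]
      push_cast
      linarith [hq.2]
    exact Nat.lt_succ_iff.1 ((Nat.floor_lt' (Nat.succ_ne_zero _)).2 h2)
  obtain ⟨b, hb, hsub⟩ := mem_nhdsGE_iff_exists_Ico_subset.1 hev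
  exact ⟨b, hb, fun q h1 h2 => funext (hsub ⟨h1, h2⟩)⟩

/-- The time of the `i`-th change of levels. -/
theorem exists_levels_time (hP : IsSystem n 0 q₀ P) (hn : 2 ≤ n) {Δ : ℝ} (hΔ : 0 < Δ) (i : ℕ) :
    ∃ t, q₀ ≤ t ∧ ∑ j, levels Δ P t j = ∑ j, levels Δ P q₀ j + i ∧
      ∀ q, q₀ ≤ q → q < t → ∑ j, levels Δ P q j < ∑ j, levels Δ P q₀ j + i := by
  set N : ℝ → ℕ := fun q => ∑ j, levels Δ P q j with hN
  have hNmono : ∀ q q', q₀ ≤ q → q ≤ q' → N q ≤ N q' := fun q q' hq hqq' =>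
    Finset.sum_le_sum fun j _ => hP.levels_mono hΔ hq hqq' j
  set S : Set ℝ := {q | q₀ ≤ q ∧ N q₀ + i ≤ N q} with hS
  have hSne : S.Nonempty := by
    set q : ℝ := max q₀ (Δ * (N q₀ + i + n)) with hq
    have hqq : q₀ ≤ q := le_max_left _ _
    refine ⟨q, hqq, ?_⟩
    have h1 : q ≤ Δ * N q + n * Δ := by
      calc q = ∑ j, P q j := (hP.S4 q hqq).symm
        _ ≤ ∑ j, (Δ * levels Δ P q j + Δ) :=
          Finset.sum_le_sum fun j _ => (lt_levels_mul_add hΔ q j).le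
        _ = _ := by
          rw [Finset.sum_add_distrib, ← Finset.mul_sum]
          simp [hN]
    have h2 : Δ * (N q₀ + i + n) ≤ q := le_max_right _ _
    have h3 : Δ * ((N q₀ + i : ℕ) : ℝ) ≤ Δ * (N q : ℝ) := by
      push_cast
      nlinarith
    exact_mod_cast le_of_mul_le_mul_left h3 hΔ
  have hSb : BddBelow S := ⟨q₀, fun q hq => hq.1⟩
  set t := sInf S with ht
  have htq : q₀ ≤ t := le_csInf hSne fun q hq => hq.1
  have hbefore : ∀ q, q₀ ≤ q → q < t → N q < N q₀ + i := by
    intro q hq hqt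
    by_contra! hcon
    exact absurd (csInf_le hSb (show q ∈ S from ⟨hq, hcon⟩)) hqt.not_ge
  refine ⟨t, htq, le_antisymm ?_ ?_, hbefore⟩
  · change N t ≤ N q₀ + i
    rcases htq.eq_or_lt with h | h
    · rw [← h]
      omega
    · obtain ⟨p, hp, hpt, m, hm⟩ := hP.exists_forall_ne_eq hn h
      -- over a time at most `Δ`, the only varying component passes at most one multiple of `Δ`
      set p' := max p (t - Δ) with hp'
      have hpp' : p ≤ p' := le_max_left _ _
      have hp't : p' < t := max_lt hpt (by linarith)
      have hle : ∀ j, levels Δ P t j ≤ levels Δ P p' j + if j = m then 1 else 0 := by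
        intro j
        split_ifs with hj
        · have h1 := hP.sub_le (hp.trans hpp') hp't.le j
          have h2 : t - Δ ≤ p' := le_max_right _ _
          have h3 : P t j / Δ ≤ P p' j / Δ + 1 := by
            rw [div_add_one hΔ.ne']
            gcongr
            linarith
          calc levels Δ P t j ≤ ⌊P p' j / Δ + 1⌋₊ := Nat.floor_mono h3
            _ = _ := Nat.floor_add_one
              (div_nonneg (hP.nonneg hn (hp.trans hpp') j) hΔ.le)
        · have h1 := hP.mono hp hpp' j
          rw [hm j hj] at h1
          exact Nat.floor_mono (div_le_div_of_nonneg_right h1 hΔ.le)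
      have h1 : N t ≤ N p' + 1 := by
        calc N t ≤ ∑ j, (levels Δ P p' j + if j = m then 1 else 0) :=
              Finset.sum_le_sum fun j _ => hle j
          _ = _ := by simp [Finset.sum_add_distrib, hN]
      have h2 := hbefore p' (hp.trans hpp') hp't
      omega
  · change N q₀ + i ≤ N t
    obtain ⟨b, hb, hconst⟩ := hP.eventually_levels_eq hΔ htq
    obtain ⟨q, hqS, hqb⟩ := exists_lt_of_csInf_lt hSne hb
    have h1 : N q = N t := by
      simp only [hN, hconst q (csInf_le hSb hqS) hqb]
    rw [← h1]
    exact hqS.2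

/-- The sequence of levels of a system: at each step one level goes up by one, and the next level to
go up is not above the one just reached.  Every `levels Δ P q` occurs in the sequence. -/
theorem exists_levels_seq (hP : IsSystem n 0 q₀ P) (hn : 2 ≤ n) {Δ : ℝ} (hΔ : 0 < Δ) :
    ∃ (f : ℕ → Fin n → ℕ) (m : ℕ → Fin n),
      (∀ i, f (i + 1) = Function.update (f i) (m i) (f i (m i) + 1)) ∧
      (∀ i, f (i + 1) (m (i + 1)) ≤ f (i + 1) (m i)) ∧
      ∀ q, q₀ ≤ q → ∃ i, levels Δ P q = f i := by
  choose t htq hN hbefore using hP.exists_levels_time hn hΔ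
  set f : ℕ → Fin n → ℕ := fun i => levels Δ P (t i) with hf
  have hNmono : ∀ q q', q₀ ≤ q → q ≤ q' → ∑ j, levels Δ P q j ≤ ∑ j, levels Δ P q' j :=
    fun q q' hq hqq' => Finset.sum_le_sum fun j _ => hP.levels_mono hΔ hq hqq' j
  have hlt : ∀ i, t i < t (i + 1) := by
    intro i
    by_contra! hcon
    have := hNmono _ _ (htq (i + 1)) hcon
    rw [hN, hN] at this
    omega
  have heq : ∀ i q, t i ≤ q → ∑ j, levels Δ P q j ≤ ∑ j, levels Δ P q₀ j + i →
      levels Δ P q = f i := by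
    intro i q hq hle
    have h1 := hP.levels_mono hΔ (htq i) hq
    have h2 : ∑ j, levels Δ P (t i) j = ∑ j, levels Δ P q j :=
      le_antisymm (hNmono _ _ (htq i) hq) (by rw [hN]; exact hle)
    funext j
    exact ((Finset.sum_eq_sum_iff_of_le fun j _ => h1 j).1 h2 j (Finset.mem_univ j)).symm
  have heq' : ∀ i q, t i ≤ q → q < t (i + 1) → levels Δ P q = f i := by
    intro i q h1 h2
    refine heq i q h1 ?_
    have := hbefore (i + 1) q ((htq i).trans h1) h2
    omega
  have hstep : ∀ i, ∃ m, f (i + 1) = Function.update (f i) m (f i m + 1) := fun i =>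
    exists_eq_update_of_sum_eq (hP.levels_mono hΔ (htq i) (hlt i).le) (by
      simp only [hf]
      rw [hN, hN]
      ring)
  choose m hm using hstep
  refine ⟨f, m, hm, fun i => ?_, fun q hq => ?_⟩
  · by_contra! hcon
    set s := t (i + 1) with hs
    set s' := t (i + 2) with hs'
    set j := m i with hj
    set j' := m (i + 1) with hj'
    have hss' : s < s' := hlt (i + 1)
    have hsq : q₀ < s := (htq i).trans_lt (hlt i)
    -- a consecutive pair of indices where the levels differ
    obtain ⟨l, l', hll', hjl, hl'j', hfl⟩ : ∃ l l' : Fin n, (l : ℕ) + 1 = l' ∧ j ≤ l ∧ l' ≤ j' ∧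
        f (i + 1) l < f (i + 1) l' := by
      by_contra! hno
      have key : ∀ d : ℕ, ∀ l : Fin n, (j : ℕ) + d = l → l ≤ j' → f (i + 1) l ≤ f (i + 1) j := by
        intro d
        induction d with
        | zero =>
          intro l h _
          rw [← Fin.ext h]
        | succ d ih =>
          intro l h hl
          have hl2 := l.2
          rw [Fin.le_def] at hl
          refine (hno ⟨j + d, by omega⟩ l (by simp only; omega) ?_ hl).trans
            (ih ⟨j + d, by omega⟩ rfl ?_)
          · rw [Fin.le_def]
            simp only
            omega
          · rw [Fin.le_def]
            simp only
            omega
      have hjj' : j ≤ j' := by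
        by_contra! h
        exact absurd (hP.levels_monotone hΔ hsq.le h.le) hcon.not_ge
      exact absurd (key (j' - j) j' (Nat.add_sub_of_le hjj') le_rfl) hcon.not_ge
    -- the partial sum up to `l` has slope `1` before `s`, hence by convexity also between `s` and
    -- `s'`; so the components above `l` are constant there, and `j'` cannot change level at `s'`
    obtain ⟨p, hp, hps, μ, hμ⟩ := hP.exists_forall_ne_eq hn hsq
    set p' := max p (t i) with hp'
    have hp's : p' < s := max_lt hps (hlt i)
    have hp'q : q₀ ≤ p' := hp.trans (le_max_left _ _)
    have hconst : ∀ r, r ≠ μ → ∀ q, p' ≤ q → q ≤ s → P q r = P s r := by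
      intro r hr q h1 h2
      have h3 := hP.mono hp ((le_max_left _ _).trans h1) r
      have h4 := hP.mono (hp'q.trans h1) h2 r
      linarith [hμ r hr]
    have hμj : μ = j := by
      by_contra hne
      have h1 := hconst j (Ne.symm hne) p' le_rfl hp's.le
      have h2 : levels Δ P p' j = f i j := congrFun (heq' i p' (le_max_right _ _) hp's) j
      have h3 : levels Δ P s j = f i j + 1 := by
        have := congrFun (hm i) j
        rwa [← hj, Function.update_self] at this
      rw [levels, h1, ← levels] at h2
      omega
    rw [hμj] at hconst
    have hjl' : j < l' := by
      rw [Fin.lt_def]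
      rw [Fin.le_def] at hjl
      omega
    have hlj' : l < j' := by
      rw [Fin.lt_def]
      rw [Fin.le_def] at hl'j'
      omega
    have hPl : P s l < P s l' := lt_of_levels_lt hΔ hfl
    have hstrict : ∀ q ∈ Set.Ioo p' s', P q l < P q l' := by
      intro q hq
      rcases le_total q s with h | h
      · rw [hconst l' hjl'.ne' q hq.1.le h]
        exact (hP.mono (hp'q.trans hq.1.le) h l).trans_lt hPl
      · refine lt_of_levels_lt hΔ ?_
        rw [heq' (i + 1) q h hq.2]
        exact hfl
    have hM1 : partialSum P l s - partialSum P l p' = s - p' := by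
      have h1 := hP.partialSum_add_sum_Ioi hp'q l
      have h2 := hP.partialSum_add_sum_Ioi hsq.le l
      have h3 : ∑ r ∈ Finset.Ioi l, P p' r = ∑ r ∈ Finset.Ioi l, P s r :=
        Finset.sum_congr rfl fun r hr => hconst r
          (hjl.trans_lt (Finset.mem_Ioi.1 hr)).ne' p' le_rfl hp's.le
      linarith
    have hM2 : partialSum P l s' - partialSum P l s < s' - s := by
      have h1 := hP.partialSum_sub_add_le hsq.le hss'.le hlj'
      have h2 : P s j' < P s' j' := by
        refine lt_of_levels_lt hΔ ?_
        have := congrFun (hm (i + 1)) j'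
        rw [← hj', Function.update_self] at this
        have h3 : levels Δ P s' j' = levels Δ P s j' + 1 := this
        omega
      linarith
    have hchord := hP.partialSum_le_chord hll' hp'q hstrict (y := s) ⟨hp's.le, hss'.le⟩
    nlinarith
  · have h0 := hNmono q₀ q le_rfl hq
    refine ⟨∑ j, levels Δ P q j - ∑ j, levels Δ P q₀ j, heq _ q ?_ (by omega)⟩
    by_contra! hcon
    have := hbefore _ q hq hcon
    omega

end IsSystem

/-- The sequence of levels is followed by labelled levels: a mover keeps moving as long as
this is possible. -/
theorem exists_isLabelPath {f : ℕ → Fin n → ℕ} {m : ℕ → Fin n}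
    (hf : ∀ i, f (i + 1) = Function.update (f i) (m i) (f i (m i) + 1))
    (hm : ∀ i, f (i + 1) (m (i + 1)) ≤ f (i + 1) (m i)) :
    ∃ r k, IsLabelPath r k ∧ ∀ i, ∃ σ : Equiv.Perm (Fin n), r i ∘ σ = f i := by
  let St : ℕ → Type := fun i => {s : (Fin n → ℕ) × Fin n × Equiv.Perm (Fin n) //
    s.1 ∘ s.2.2 = f i ∧ s.1 s.2.1 = f i (m i)}
  have hstep : ∀ i (s : St i), ∃ s' : St (i + 1),
      s'.1.1 = Function.update s.1.1 s.1.2.1 (s.1.1 s.1.2.1 + 1) ∧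
      (s'.1.2.1 = s.1.2.1 ∨ s'.1.1 s'.1.2.1 < s'.1.1 s.1.2.1) := by
    rintro i ⟨⟨r, k, σ⟩, hσ, hk⟩
    simp only at hσ hk
    have hσ' : ∀ j, r (σ j) = f i j := fun j => congrFun hσ j
    set r' := Function.update r k (r k + 1) with hr'
    set σ' : Equiv.Perm (Fin n) := σ.trans (Equiv.swap k (σ (m i))) with hσ'def
    have hrσ : r' ∘ σ' = f (i + 1) := by
      funext j
      rw [hf i, Function.comp_apply, hσ'def, Equiv.trans_apply]
      rcases eq_or_ne j (m i) with rfl | hj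
      · rw [Equiv.swap_apply_right, hr', Function.update_self, Function.update_self, hk]
      · rw [Function.update_of_ne hj]
        rcases eq_or_ne (σ j) k with h | h
        · rw [h, Equiv.swap_apply_left, hr', Function.update_of_ne, hσ', ← hk, ← h, hσ']
          rw [← h]
          exact fun h2 => hj (σ.injective h2).symm
        · rw [Equiv.swap_apply_of_ne_of_ne h (fun h2 => hj (σ.injective h2)), hr',
            Function.update_of_ne h, hσ']
    have hr'k : r' k = f (i + 1) (m i) := by
      rw [hr', Function.update_self, hf i, Function.update_self, hk]
    by_cases hcase : r' k = f (i + 1) (m (i + 1))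
    · exact ⟨⟨⟨r', k, σ'⟩, hrσ, hcase⟩, rfl, Or.inl rfl⟩
    · have h1 : r' (σ' (m (i + 1))) = f (i + 1) (m (i + 1)) := congrFun hrσ _
      refine ⟨⟨⟨r', σ' (m (i + 1)), σ'⟩, hrσ, h1⟩, rfl, Or.inr ?_⟩
      simp only
      rw [h1]
      have := hm i
      omega
  choose next hnext using hstep
  let s : ∀ i, St i := fun i => Nat.rec ⟨⟨f 0, m 0, 1⟩, rfl, rfl⟩ next i
  exact ⟨fun i => (s i).1.1, fun i => (s i).1.2.1,
    ⟨fun i => (hnext i (s i)).1, fun i => (hnext i (s i)).2⟩, fun i => ⟨(s i).1.2.2, (s i).2.1⟩⟩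

end

end ParamGeom

/-- The norm in the conclusion is the maximum norm of `Fin n → ℝ`. -/
theorem mainTheorem4 (n : ℕ) (hn : 2 ≤ n) (q₀ : ℝ) (hq₀ : 0 ≤ q₀) (P : ℝ → Fin n → ℝ)
    (hP : ParamGeom.IsSystem n 0 q₀ P) :
    ∃ u : EuclideanSpace ℝ (Fin n), ‖u‖ = 1 ∧
      ∀ q : ℝ, q₀ ≤ q → ‖P q - ParamGeom.succMin u q‖ ≤ 3 * (n : ℝ) ^ 2 * ((n : ℝ) + 9) := by
  have hn' : (2 : ℝ) ≤ n := by exact_mod_cast hn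
  set δ : ℝ := 2 * n + 10 with hδdef
  have hδ0 : 0 < δ := by positivity
  have hδ : 1000 * 5 ^ n ≤ Real.exp δ := by
    have e1 : (2.7 : ℝ) ≤ Real.exp 1 := by linarith [Real.exp_one_gt_d9]
    have e2 : Real.exp δ = (Real.exp 1 ^ 2) ^ n * Real.exp 1 ^ 10 := by
      rw [hδdef, Real.exp_add, ← pow_mul, ← Real.exp_nat_mul, ← Real.exp_nat_mul]
      push_cast
      norm_num
    rw [e2, mul_comm]
    have e3 : (5 : ℝ) ≤ Real.exp 1 ^ 2 := by
      calc (5 : ℝ) ≤ 2.7 ^ 2 := by norm_num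
        _ ≤ _ := by gcongr
    have e4 : (1000 : ℝ) ≤ Real.exp 1 ^ 10 := by
      calc (1000 : ℝ) ≤ 2.7 ^ 10 := by norm_num
        _ ≤ _ := by gcongr
    gcongr
  set Δ : ℝ := n * δ with hΔdef
  have hΔ : 0 < Δ := by positivity
  obtain ⟨f, m, hf, hm, hlev⟩ := hP.exists_levels_seq hn hΔ
  obtain ⟨r, k, hpath, hperm⟩ := ParamGeom.exists_isLabelPath hf hm
  obtain ⟨u, hu, hbases⟩ := hpath.exists_unit hδ0 hδ
  refine ⟨u, hu, fun q hq => ?_⟩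
  obtain ⟨i, hi⟩ := hlev q hq
  obtain ⟨σ, hσ⟩ := hperm i
  obtain ⟨x, hint, hx, h1, h2⟩ := hbases i
  set a := ParamGeom.labelSize δ (r i) with ha
  set τ := Tuple.sort a with hτ
  have hτa : Monotone (a ∘ τ) := Tuple.monotone_sort a
  have hτr : Monotone (r i ∘ τ) := by
    intro j j' hjj'
    by_contra! hcon
    exact absurd (hτa hjj') (ParamGeom.labelSize_lt_of_lt hδ0 (r i) hcon).not_ge
  -- both orderings of the levels are monotone, hence equal, although `σ` and `τ` may differ
  have hrτ : r i ∘ τ = ParamGeom.levels Δ P q := by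
    rw [hi, ← hσ]
    refine Tuple.unique_monotone hτr ?_
    rw [hσ, ← hi]
    exact hP.levels_monotone hΔ hq
  have haP : ∀ j, |P q j - a (τ j)| ≤ Δ := by
    intro j
    have e1 := hP.levels_mul_le hn hΔ hq j
    have e2 := ParamGeom.IsSystem.lt_levels_mul_add (P := P) hΔ q j
    have e3 : a (τ j) = Δ * ParamGeom.levels Δ P q j + δ * ((τ j : ℕ) + 1) := by
      rw [← hrτ, ha, ParamGeom.labelSize, Function.comp_apply]
      push_cast
      ring
    have e4 : δ * ((τ j : ℕ) + 1) ≤ Δ := by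
      rw [hΔdef, mul_comm (n : ℝ)]
      gcongr
      exact_mod_cast (τ j).2
    have e5 : 0 ≤ δ * (((τ j : ℕ) : ℝ) + 1) := by positivity
    rw [abs_le]
    constructor <;> linarith
  have haq : |q - ∑ j, a j| ≤ n * Δ := by
    rw [← hP.S4 q hq, ← Equiv.sum_comp τ a, ← Finset.sum_sub_distrib]
    calc _ ≤ ∑ j, |P q j - a (τ j)| := Finset.abs_sum_le_sum_abs _ _
      _ ≤ ∑ j : Fin n, Δ := Finset.sum_le_sum fun j _ => haP j
      _ = n * Δ := by simp
  have ha0 : ∀ j, 0 ≤ a j := fun j => hδ0.le.trans (ParamGeom.le_labelSize hδ0 _ j)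
  rw [pi_norm_le_iff_of_nonneg (by positivity)]
  intro j
  rw [Pi.sub_apply, Real.norm_eq_abs]
  have e1 := ParamGeom.abs_succMin_sub_le_of_basis hu ha0 (by positivity) hint hx h1 h2 τ hτa j
  have e2 := ParamGeom.abs_succMin_sub_le hu (hq₀.trans hq) (Finset.sum_nonneg fun j _ => ha0 j) j
    (q' := ∑ j, a j)
  have e3 := abs_sub_le (P q j) (a (τ j)) (ParamGeom.succMin u q j)
  have e4 := abs_sub_le (ParamGeom.succMin u q j) (ParamGeom.succMin u (∑ j, a j) j) (a (τ j))
  rw [abs_sub_comm (a (τ j))] at e3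
  have e5 := haP j
  -- the errors `Δ`, `n (n + 2) + n` and `n Δ` add up to `2 n³ + 13 n² + 13 n`
  rw [hΔdef, hδdef] at *
  nlinarith
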